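/- Let $n\ge 0$. A Stirling permutation of order $n$ is a permutation $\sigma=\sigma_1\sigma_2\cdots\sigma_{2n}$ of the multiset $\{1,1,2,2,\ldots,n,n\}$ such that, for every $i\in\{1,\dots,n\}$, every element between the two occurrences of $i$ is greater than $i$. It contains a pattern $\tau=\tau_1\cdots\tau_k$ if there are positions $1\le i_1<\cdots<i_k\le 2n$ such that $\sigma_{i_s}<\sigma_{i_t}$ whenever $\tau_s<\tau_t$, and it avoids $\tau$ otherwise; let $\mathcal{Q}_n(\tau)$ be the set of Stirling permutations of order $n$ that avoid $\tau$. Let $\mathrm{plat}(\sigma)$ and $\mathrm{des}(\sigma)$ be the numbers of indices $1\le i\le 2n-1$ with $\sigma_i=\sigma_{i+1}$ (plateaus) and with $\sigma_i>\sigma_{i+1}$ (descents), respectively. Then, as polynomials in $q$, $$\sum_{\sigma\in \mathcal{Q}_n(132)}q^{\mathrm{plat}(\sigma)}=\sum_{\sigma\in \mathcal{Q}_n(123)}q^{\mathrm{plat}(\sigma)}.$$ Moreover, for every $d\ge 0$, the number of $132$-avoiding Stirling permutations of order $n$ with exactly $d$ descents is $$\frac{\binom{n-1}{d}}{n+1}\sum_{j=0}^{n+1}\binom{n+1}{j}\binom{j}{d+1-j}.$$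 Here $\binom{a}{b}=0$ if $b<0$ or $b>a\ge 0$, and for $n=0$ the convention is $\binom{-1}{0}=1$ and $\binom{-1}{d}=0$ for $d\ge 1$. -/

import Mathlib

/-- The condition defining Stirling permutations: every letter between two occurrences of
a letter is greater than that letter. -/
def IsStirling (w : List ℕ) : Prop :=
  ∀ i j k : Fin w.length, i < j → j < k → w.get i = w.get k → w.get i < w.get j

instance (w : List ℕ) : Decidable (IsStirling w) := by
  unfold IsStirling; infer_instance

/-- `w` contains the pattern `τ`: there are positions `f 0 < f 1 < ⋯` in `w`, one for every letter
of `τ`, such that the letter of `w` at `f s` is less than that at `f t` whenever `τ_s < τ_t`. -/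
def ContainsPattern (τ w : List ℕ) : Prop :=
  ∃ f : Fin τ.length → Fin w.length, StrictMono f ∧
    ∀ s t : Fin τ.length, τ.get s < τ.get t → w.get (f s) < w.get (f t)

instance (τ w : List ℕ) : Decidable (ContainsPattern τ w) := by
  unfold ContainsPattern StrictMono; infer_instance

/-- The Stirling permutations of order `n`: the words that are rearrangements of the multiset
`{1, 1, 2, 2, …, n, n}` and satisfy the Stirling condition. -/
def stirlingPerms (n : ℕ) : Finset (List ℕ) :=
  (Multiset.lists (2 • (Finset.Icc 1 n).val)).toFinset.filter fun w => IsStirling w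

/-- The Stirling permutations of order `n` that avoid the pattern `τ`. -/
def avoiders (n : ℕ) (τ : List ℕ) : Finset (List ℕ) :=
  (stirlingPerms n).filter fun w => ¬ ContainsPattern τ w

/-- The number of plateaus: the number of pairs of adjacent equal letters. -/
def plat (w : List ℕ) : ℕ := (w.zip w.tail).countP fun p => p.1 = p.2

/-- The number of descents: the number of pairs of adjacent letters the first of which is
the greater one. -/
def des (w : List ℕ) : ℕ := (w.zip w.tail).countP fun p => p.1 > p.2

/-- Binomial coefficients with integer arguments: the usual `Nat.choose` for `a, b ≥ 0`, and
`0` for `b < 0`. A negative upper argument is read as `0`; in particular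
`binom (-1) 0 = 1` and `binom (-1) d = 0` for `d ≥ 1`. -/
def binom (a b : ℤ) : ℕ := if 0 ≤ b then Nat.choose a.toNat b.toNat else 0

/-!
Removing the two copies of the least letter `m` from a Stirling word `A m B m C` gives a Stirling
word `A B C`, and avoidance of `132` or of `123` survives. Conversely, `m` may be inserted before
`B C` and before `C` exactly when both are *good* suffixes (`GoodSuffix`): weakly increasing for
`132`, weakly decreasing for `123`, and cutting no pair of equal letters (`sum_words_succ`). Hence
the avoiders form a generating tree, in which a word is labelled by its number of good suffixes. If
`B C` and `C` are two different good suffixes, the label of the new word is the rank of `C` among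
the good suffixes, for either pattern. If they coincide, a plateau is created, and the label is the
rank plus one for `132`; for `123` it is the rank, except that rank one (insertion at the end) leads
to the number of all good suffixes plus one. Both rules produce the labels `2, …, k + 1` from the
label `k`, so the trees agree and plateaus are equidistributed (`sum_plat_gt_eq_lt`).

For descents of `132`-avoiders one more bit belongs to the label: whether the gap before the longest
good suffix is *free*, that is, at the front or at a descent, so that an insertion there creates no
descent on its left (`freeGap_iff`, `sum_des_succ`). Let `x` mark half the length, `q` descents, let
`w = x (1 + w) (1 + q w + q² w²)` and `u = w / (1 + w)`. A label grows by at most one in a step, so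
its generating function is geometric: the words with `h + 1` good suffixes contribute `u ^ h` with
the bit set and `q w u · u ^ h` without it. This is checked against the recursion in
`labelSum_desStep`. Summing over `h` yields `1 + w + q w²` (`sum_des_eq_coeff`), and Lagrange
inversion (`lagrange_inversion`) gives the coefficient of `x ^ n` as
`[t ^ (n - 1)] (1 + 2 q t) ((1 + t) (1 + q t + q² t²)) ^ n / n`. The binomial formula follows from
`(n + 1) (1 + 2 s) (1 + s + s²) ^ n = ((1 + s + s²) ^ (n + 1))'` with `s = q t`.
-/

/-! ### Stirling words as lists -/

/-- Every letter enclosed by two equal letters is greater than these. -/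
def StirlingWord (w : List ℕ) : Prop :=
  ∀ a b, [a, b, a].Sublist w → a < b

/-- No letter `a` of `w` is followed by greater letters `b`, `c`, in this order, with `r b c`.
For `r = (· > ·)` this is avoidance of `132`, for `r = (· < ·)` avoidance of `123`. -/
def AvoidsRel (r : ℕ → ℕ → Prop) (w : List ℕ) : Prop :=
  ∀ a b c, [a, b, c].Sublist w → a < b → a < c → ¬ r b c

theorem triple_sublist_iff (a b c : ℕ) (w : List ℕ) :
    [a, b, c].Sublist w ↔ ∃ i j k : Fin w.length, i < j ∧ j < k ∧
      w.get i = a ∧ w.get j = b ∧ w.get k = c := by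
  rw [List.sublist_iff_exists_fin_orderEmbedding_get_eq]
  constructor
  · rintro ⟨f, hf⟩
    refine ⟨f ⟨0, by simp⟩, f ⟨1, by simp⟩, f ⟨2, by simp⟩, ?_, ?_, ?_, ?_, ?_⟩
    · exact f.lt_iff_lt.2 (by simp)
    · exact f.lt_iff_lt.2 (by simp)
    · exact (hf ⟨0, by simp⟩).symm
    · exact (hf ⟨1, by simp⟩).symm
    · exact (hf ⟨2, by simp⟩).symm
  · rintro ⟨i, j, k, hij, hjk, rfl, rfl, rfl⟩
    have hmono : StrictMono (![i, j, k] : Fin 3 → Fin w.length) := by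
      refine Fin.strictMono_iff_lt_succ.2 fun s => ?_
      fin_cases s
      · exact hij
      · exact hjk
    refine ⟨OrderEmbedding.ofStrictMono (![i, j, k] : Fin 3 → Fin w.length) hmono, fun s => ?_⟩
    change Fin 3 at s
    fin_cases s <;> rfl

theorem isStirling_iff (w : List ℕ) : IsStirling w ↔ StirlingWord w := by
  constructor
  · intro h a b hs
    obtain ⟨i, j, k, hij, hjk, rfl, rfl, hk⟩ := (triple_sublist_iff _ _ _ _).1 hs
    exact h i j k hij hjk hk.symm
  · intro h i j k hij hjk he
    exact h _ _ ((triple_sublist_iff _ _ _ _).2 ⟨i, j, k, hij, hjk, rfl, rfl, he.symm⟩)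

theorem containsPattern_iff (p q s : ℕ) (w : List ℕ) :
    ContainsPattern [p, q, s] w ↔ ∃ i j k : Fin w.length, i < j ∧ j < k ∧
      ∀ x y : Fin 3, ![p, q, s] x < ![p, q, s] y →
        w.get (![i, j, k] x) < w.get (![i, j, k] y) := by
  constructor
  · rintro ⟨f, hf, h⟩
    refine ⟨f ⟨0, by simp⟩, f ⟨1, by simp⟩, f ⟨2, by simp⟩, hf (by simp), hf (by simp), ?_⟩
    intro x y
    have := h x y
    fin_cases x <;> fin_cases y <;> exact this
  · rintro ⟨i, j, k, hij, hjk, h⟩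
    refine ⟨(![i, j, k] : Fin 3 → Fin w.length), ?_, ?_⟩
    · refine Fin.strictMono_iff_lt_succ.2 fun s => ?_
      change Fin 2 at s
      fin_cases s
      · exact hij
      · exact hjk
    · intro x y
      change Fin 3 at x y
      have := h x y
      fin_cases x <;> fin_cases y <;> exact this

theorem not_containsPattern_132_iff (w : List ℕ) :
    ¬ ContainsPattern [1, 3, 2] w ↔ AvoidsRel (· > ·) w := by
  rw [containsPattern_iff]
  constructor
  · intro h a b c hs hab hac hbc
    obtain ⟨i, j, k, hij, hjk, rfl, rfl, rfl⟩ := (triple_sublist_iff _ _ _ _).1 hs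
    refine h ⟨i, j, k, hij, hjk, fun x y hxy => ?_⟩
    fin_cases x <;> fin_cases y <;> simp_all
  · rintro h ⟨i, j, k, hij, hjk, hp⟩
    exact h _ _ _ ((triple_sublist_iff _ _ _ _).2 ⟨i, j, k, hij, hjk, rfl, rfl, rfl⟩)
      (hp 0 1 (by simp)) (hp 0 2 (by simp)) (hp 2 1 (by simp))

theorem not_containsPattern_123_iff (w : List ℕ) :
    ¬ ContainsPattern [1, 2, 3] w ↔ AvoidsRel (· < ·) w := by
  rw [containsPattern_iff]
  constructor
  · intro h a b c hs hab hac hbc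
    obtain ⟨i, j, k, hij, hjk, rfl, rfl, rfl⟩ := (triple_sublist_iff _ _ _ _).1 hs
    refine h ⟨i, j, k, hij, hjk, fun x y hxy => ?_⟩
    fin_cases x <;> fin_cases y <;> simp_all
  · rintro h ⟨i, j, k, hij, hjk, hp⟩
    exact h _ _ _ ((triple_sublist_iff _ _ _ _).2 ⟨i, j, k, hij, hjk, rfl, rfl, rfl⟩)
      (hp 0 1 (by simp)) (hp 0 2 (by simp)) (hp 1 2 (by simp))

open Classical in
/-- The Stirling words with the letters `m, m, m + 1, m + 1, …, m + k - 1, m + k - 1` that avoid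
the relation `r` in the sense of `AvoidsRel`. -/
noncomputable def words (r : ℕ → ℕ → Prop) (m k : ℕ) : Finset (List ℕ) :=
  (Multiset.lists (2 • (Finset.Ico m (m + k)).val)).toFinset.filter
    fun w => StirlingWord w ∧ AvoidsRel r w

theorem mem_words {r : ℕ → ℕ → Prop} {m k : ℕ} {w : List ℕ} :
    w ∈ words r m k ↔ (∀ a, w.count a = if m ≤ a ∧ a < m + k then 2 else 0) ∧
      StirlingWord w ∧ AvoidsRel r w := by
  classical
  simp only [words, Finset.mem_filter, Multiset.mem_toFinset, Multiset.mem_lists_iff]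
  change (_ = (w : Multiset ℕ) ∧ _) ↔ _
  rw [Multiset.ext]
  refine and_congr_left fun _ => forall_congr' fun a => ?_
  rw [Multiset.coe_count, Multiset.count_nsmul, Multiset.count_eq_of_nodup (Finset.nodup _)]
  simp only [Finset.mem_val, Finset.mem_Ico]
  constructor <;> intro h <;> split_ifs at * <;> omega

theorem avoiders_eq_words (n : ℕ) (τ : List ℕ) (r : ℕ → ℕ → Prop)
    (h : ∀ w, ¬ ContainsPattern τ w ↔ AvoidsRel r w) : avoiders n τ = words r 1 n := by
  ext w
  have hI : Finset.Icc 1 n = Finset.Ico 1 (1 + n) := by ext; simp; omega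
  simp only [avoiders, stirlingPerms, words, Finset.mem_filter, isStirling_iff, h, hI, and_assoc]

theorem words_zero (r : ℕ → ℕ → Prop) (m : ℕ) : words r m 0 = {[]} := by
  ext w
  rw [mem_words, Finset.mem_singleton]
  constructor
  · rintro ⟨h, -⟩
    refine List.eq_nil_iff_forall_not_mem.2 fun a ha => ?_
    have := h a
    have h2 := List.count_pos_iff.2 ha
    split_ifs at this <;> omega
  · rintro rfl
    refine ⟨fun a => ?_, fun a b h => ?_, fun a b c h => ?_⟩
    · rw [if_neg (by omega)]; rfl
    · simp at h
    · simp at h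

theorem le_of_mem_words {r : ℕ → ℕ → Prop} {m k a : ℕ} {w : List ℕ}
    (hw : w ∈ words r m k) (ha : a ∈ w) : m ≤ a ∧ w.count a = 2 := by
  have h := (mem_words.1 hw).1 a
  have h2 := List.count_pos_iff.2 ha
  split_ifs at h <;> omega

/-! ### Inserting the least letter -/

/-- `C` is a suffix before which a letter smaller than all the others may be inserted: no
occurrence of `r` would complete the forbidden pattern, and no pair of equal letters would
enclose the new letter. -/
def GoodSuffix (r : ℕ → ℕ → Prop) (C : List ℕ) : Prop :=
  C.Pairwise (fun b c => ¬ r b c) ∧ ∀ a ∈ C, C.count a = 2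

theorem mem_of_enclosing_sublist {a b x : ℕ} {A R : List ℕ} (hax : a ≠ x) (hA : x ∉ A)
    (h : [a, x, b].Sublist (A ++ x :: R)) : (a ∈ A ∧ b ∈ R) ∨ [a, x, b].Sublist R := by
  obtain ⟨l₁, l₂, he, h₁, h₂⟩ := List.sublist_append_iff.1 h
  match l₁, he with
  | [], he =>
    right
    simp only [List.nil_append] at he
    subst he
    cases h₂ with
    | cons _ h => exact h
    | cons_cons => exact absurd rfl hax
  | [y], he =>
    left
    simp only [List.cons_append, List.nil_append, List.cons.injEq] at he
    obtain ⟨rfl, rfl⟩ := he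
    exact ⟨by simpa using h₁, by simpa using h₂⟩
  | y :: z :: t, he =>
    simp only [List.cons_append, List.cons.injEq] at he
    obtain ⟨rfl, rfl, -⟩ := he
    exact absurd (h₁.subset (by simp)) hA

theorem filter_insert {x : ℕ} {A B C : List ℕ} (h : x ∉ A ++ (B ++ C)) :
    (A ++ x :: (B ++ x :: C)).filter (fun y => decide (y ≠ x)) = A ++ (B ++ C) := by
  simp only [List.mem_append, not_or] at h
  have key : ∀ D : List ℕ, x ∉ D → D.filter (fun y => decide (y ≠ x)) = D := fun D hD =>
    List.filter_eq_self.2 fun y hy => by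
      simp only [decide_eq_true_eq]; rintro rfl; exact hD hy
  simp only [List.filter_append, List.filter_cons, key _ h.1, key _ h.2.1, key _ h.2.2]
  simp

theorem sublist_of_sublist_insert {x : ℕ} {A B C l : List ℕ} (h : x ∉ A ++ (B ++ C))
    (hl : x ∉ l) (hs : l.Sublist (A ++ x :: (B ++ x :: C))) : l.Sublist (A ++ (B ++ C)) := by
  have := hs.filter (fun y => decide (y ≠ x))
  rw [filter_insert h, List.filter_eq_self.2] at this
  · exact this
  · intro y hy
    simp only [decide_eq_true_eq]; rintro rfl; exact hl hy

theorem sublist_insert (x : ℕ) (A B C : List ℕ) :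
    (A ++ (B ++ C)).Sublist (A ++ x :: (B ++ x :: C)) :=
  (List.Sublist.refl A).append
    (((List.Sublist.refl B).append (List.sublist_cons_self x C)).cons x)

theorem count_insert (x a : ℕ) (A B C : List ℕ) :
    (A ++ x :: (B ++ x :: C)).count a = (A ++ (B ++ C)).count a + if x = a then 2 else 0 := by
  simp only [List.count_append, List.count_cons, beq_iff_eq]
  split_ifs <;> omega

theorem insert_mem_words {r : ℕ → ℕ → Prop} {m k : ℕ} {A B C : List ℕ}
    (hw : A ++ (B ++ C) ∈ words r (m + 1) k) (hBC : GoodSuffix r (B ++ C)) (hC : GoodSuffix r C) :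
    A ++ m :: (B ++ m :: C) ∈ words r m (k + 1) := by
  have hm : m ∉ A ++ (B ++ C) := fun h => by have := (le_of_mem_words hw h).1; omega
  have hge : ∀ y, y ∈ A ++ m :: (B ++ m :: C) → y = m ∨ m < y := by
    intro y hy
    by_cases hym : y = m
    · exact Or.inl hym
    · right
      have : y ∈ A ++ (B ++ C) := by simpa [hym] using hy
      exact (le_of_mem_words hw this).1
  have hcm : (A ++ m :: (B ++ m :: C)).count m = 2 := by
    rw [count_insert, List.count_eq_zero.2 hm]; simp
  obtain ⟨hcnt, hst, hav⟩ := mem_words.1 hw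
  refine mem_words.2 ⟨fun a => ?_, fun a b hs => ?_, fun a b c hs hab hac => ?_⟩
  · rw [count_insert, hcnt]
    split_ifs <;> omega
  · by_cases ham : a = m
    · subst ham
      rcases hge b (hs.subset (by simp)) with rfl | h
      · have := hs.count_le b
        simp [hcm] at this
      · exact h
    by_cases hbm : b = m
    · exfalso
      subst hbm
      have hm' : b ∉ A ∧ b ∉ B ∧ b ∉ C := by simpa using hm
      have haw : ∀ D : List ℕ, a ∈ D → 0 < D.count a := fun D h => List.count_pos_iff.2 h
      have h2 : a ∈ A ++ (B ++ C) → (A ++ (B ++ C)).count a = 2 :=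
        fun h => (le_of_mem_words hw h).2
      rcases mem_of_enclosing_sublist ham hm'.1 hs with ⟨h₁, h₃⟩ | h
      · have h₃ : a ∈ B ++ C := by simpa [ham] using h₃
        have e1 := hBC.2 a h₃
        have e2 := h2 (by simp [h₁])
        have e3 := haw A h₁
        rw [List.count_append] at e2
        omega
      · rcases mem_of_enclosing_sublist ham hm'.2.1 h with ⟨h₁, h₃⟩ | h
        · have e1 := hC.2 a h₃
          have e2 := h2 (by simp [h₁])
          have e3 := haw B h₁
          simp only [List.count_append] at e2
          omega
        · exact hm'.2.2 (h.subset (by simp))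
    · exact hst _ _ (sublist_of_sublist_insert hm (by simp; grind) hs)
  · by_cases ham : a = m
    · subst ham
      have hm' : a ∉ A ∧ a ∉ B ∧ a ∉ C := by simpa using hm
      have h1 : [b, c].Sublist (B ++ a :: C) := by
        obtain ⟨l₁, l₂, he, h₁, h₂⟩ := List.sublist_append_iff.1 hs
        match l₁, he with
        | [], he =>
          simp only [List.nil_append] at he
          subst he
          cases h₂ with
          | cons _ h => exact (List.sublist_cons_self _ _).trans h
          | cons_cons _ h => exact h
        | y :: t, he =>
          simp only [List.cons_append, List.cons.injEq] at he
          obtain ⟨rfl, -⟩ := he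
          exact absurd (h₁.subset (by simp)) hm'.1
      have h2 : [b, c].Sublist (B ++ C) :=
        sublist_of_sublist_insert (A := []) (B := B) (C := C) (by simp [hm'])
          (l := [b, c]) (by simp; omega) (h1.cons a)
      exact hBC.1.forall_sublist h2
    · have := hge a (hs.subset (by simp))
      exact hav _ _ _ (sublist_of_sublist_insert hm (by simp; omega) hs) hab hac

theorem exists_insert_of_mem_words {r : ℕ → ℕ → Prop} {m k : ℕ} {v : List ℕ}
    (hv : v ∈ words r m (k + 1)) :
    ∃ A B C, v = A ++ m :: (B ++ m :: C) ∧ A ++ (B ++ C) ∈ words r (m + 1) k ∧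
      GoodSuffix r (B ++ C) ∧ GoodSuffix r C := by
  obtain ⟨hcnt, hst, hav⟩ := mem_words.1 hv
  have hm2 : v.count m = 2 := by rw [hcnt, if_pos (by omega)]
  obtain ⟨A, R, rfl, hA⟩ := List.eq_append_cons_of_mem
    (List.count_pos_iff.1 (by omega : 0 < v.count m))
  have hR : R.count m = 1 := by
    simp [List.count_append, List.count_eq_zero.2 hA] at hm2
    exact hm2
  obtain ⟨B, C, rfl, hB⟩ := List.eq_append_cons_of_mem
    (List.count_pos_iff.1 (by omega : 0 < R.count m))
  have hC : m ∉ C := by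
    simp [List.count_append, List.count_eq_zero.2 hB] at hR
    exact List.count_eq_zero.1 hR
  have hm : m ∉ A ++ (B ++ C) := by simp [hA, hB, hC]
  have hsub := sublist_insert m A B C
  have hw : A ++ (B ++ C) ∈ words r (m + 1) k := by
    refine mem_words.2 ⟨fun a => ?_, fun a b hs => hst a b (hs.trans hsub),
      fun a b c hs => hav a b c (hs.trans hsub)⟩
    have h := hcnt a
    rw [count_insert] at h
    by_cases ham : m = a
    · subst ham
      rw [List.count_eq_zero.2 hm, if_neg (by omega)]
    · rw [if_neg ham] at h
      rw [Nat.add_zero] at h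
      rw [h]
      split_ifs <;> omega
  have hlt : ∀ a ∈ A ++ (B ++ C), m < a := fun a ha => (le_of_mem_words hw ha).1
  have hpw : (B ++ C).Pairwise (fun b c => ¬ r b c) := by
    refine List.pairwise_of_forall_sublist fun {b c} hs => ?_
    have hs' : [m, b, c].Sublist (A ++ m :: (B ++ m :: C)) := by
      refine List.Sublist.trans ?_ (List.sublist_append_right _ _)
      exact (hs.trans ((List.Sublist.refl B).append (List.sublist_cons_self m C))).cons_cons m
    refine hav m b c hs' (hlt b ?_) (hlt c ?_)
    · exact List.mem_append_right _ (hs.subset (by simp))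
    · exact List.mem_append_right _ (hs.subset (by simp))
  refine ⟨A, B, C, rfl, hw, ⟨hpw, fun a ha => ?_⟩, ⟨?_, fun a ha => ?_⟩⟩
  · have haw : a ∈ A ++ (B ++ C) := List.mem_append_right _ ha
    have h2 := (le_of_mem_words hw haw).2
    have hnA : a ∉ A := by
      intro haA
      have hs : [a, m, a].Sublist (A ++ m :: (B ++ m :: C)) := by
        refine List.Sublist.append (l₁ := [a]) (r₁ := [m, a]) (by simpa using haA) ?_
        refine List.Sublist.cons_cons m ?_
        simp only [List.singleton_sublist]
        simp only [List.mem_append] at ha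
        simp; tauto
      have := hst a m hs
      have := hlt a haw
      omega
    rwa [List.count_append, List.count_eq_zero.2 hnA, Nat.zero_add] at h2
  · exact (List.pairwise_append.1 hpw).2.1
  · have haw : a ∈ A ++ (B ++ C) := by simp [ha]
    have h2 := (le_of_mem_words hw haw).2
    have hnAB : a ∉ A ++ B := by
      intro haA
      have hs : [a, m, a].Sublist ((A ++ m :: B) ++ m :: C) := by
        refine List.Sublist.append (l₁ := [a]) (r₁ := [m, a]) ?_ ?_
        · simp only [List.singleton_sublist]
          simp only [List.mem_append] at haA
          simp; tauto
        · exact List.Sublist.cons_cons m (by simpa using ha)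
      have := hst a m (by simpa using hs)
      have := hlt a haw
      omega
    rwa [← List.append_assoc, List.count_append, List.count_eq_zero.2 hnAB, Nat.zero_add] at h2

/-! ### The recursion for words -/

open Classical in
/-- The suffixes of `w` that are good in the sense of `GoodSuffix`. -/
noncomputable def goodSuffixes (r : ℕ → ℕ → Prop) (w : List ℕ) : Finset (List ℕ) :=
  w.tails.toFinset.filter (GoodSuffix r)

theorem mem_goodSuffixes {r : ℕ → ℕ → Prop} {w C : List ℕ} :
    C ∈ goodSuffixes r w ↔ C <:+ w ∧ GoodSuffix r C := by
  classical
  simp [goodSuffixes]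

theorem nil_mem_goodSuffixes (r : ℕ → ℕ → Prop) (w : List ℕ) : [] ∈ goodSuffixes r w :=
  mem_goodSuffixes.2 ⟨List.nil_suffix, by simp [GoodSuffix]⟩

/-- For suffixes `C'` and `C` of `w`, the latter not longer than the former: `w` with the letter
`x` inserted before `C'` and before `C`. -/
def insertPair (x : ℕ) (w C' C : List ℕ) : List ℕ :=
  w.take (w.length - C'.length) ++ x :: (C'.take (C'.length - C.length) ++ x :: C)

theorem insertPair_append (x : ℕ) (A B C : List ℕ) :
    insertPair x (A ++ (B ++ C)) (B ++ C) C = A ++ x :: (B ++ x :: C) := by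
  simp [insertPair]

theorem exists_append_of_suffix {w C C' : List ℕ} (h : C <:+ w) (h' : C' <:+ w)
    (hl : C.length ≤ C'.length) : ∃ A B, w = A ++ (B ++ C) ∧ C' = B ++ C := by
  obtain ⟨A, rfl⟩ := h'
  obtain ⟨B, rfl⟩ := List.suffix_of_suffix_length_le h (List.suffix_append A C') hl
  exact ⟨A, B, rfl, rfl⟩

theorem append_cons_inj {x : ℕ} {A A' R R' : List ℕ} (hA : x ∉ A) (hA' : x ∉ A')
    (h : A ++ x :: R = A' ++ x :: R') : A = A' ∧ R = R' := by
  induction A generalizing A' with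
  | nil =>
    cases A' with
    | nil => simpa using h
    | cons y t => simp at h; simp [h.1] at hA'
  | cons a A ih =>
    cases A' with
    | nil => simp at h; simp [h.1] at hA
    | cons y t =>
      simp only [List.cons_append, List.cons.injEq] at h
      simp only [List.mem_cons, not_or] at hA hA'
      obtain ⟨rfl, h2⟩ := ih hA.2 hA'.2 h.2
      exact ⟨by rw [h.1], h2⟩

/-- The words on the letters `m, …, m + k` arise from those on the letters `m + 1, …, m + k`, each
in exactly one way, by inserting the letter `m` before two good suffixes. -/
theorem sum_words_succ {M : Type*} [AddCommMonoid M] (r : ℕ → ℕ → Prop) (m k : ℕ)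
    (G : List ℕ → M) :
    ∑ v ∈ words r m (k + 1), G v =
      ∑ w ∈ words r (m + 1) k, ∑ C ∈ goodSuffixes r w,
        ∑ C' ∈ (goodSuffixes r w).filter (fun C' => C.length ≤ C'.length),
          G (insertPair m w C' C) := by
  rw [Finset.sum_congr rfl fun w _ => Finset.sum_sigma' (goodSuffixes r w)
    (fun C => (goodSuffixes r w).filter (fun C' => C.length ≤ C'.length))
    (fun C C' => G (insertPair m w C' C)), Finset.sum_sigma']
  symm
  refine Finset.sum_bij (fun x _ => insertPair m x.1 x.2.2 x.2.1) ?_ ?_ ?_ ?_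
  · rintro ⟨w, C, C'⟩ h
    simp only [Finset.mem_sigma, Finset.mem_filter, mem_goodSuffixes] at h
    obtain ⟨hw, ⟨hC, hC2⟩, ⟨hC', hC2'⟩, hl⟩ := h
    obtain ⟨A, B, rfl, rfl⟩ := exists_append_of_suffix hC hC' hl
    rw [insertPair_append]
    exact insert_mem_words hw hC2' hC2
  · rintro ⟨w, C, C'⟩ h ⟨w₁, C₁, C₁'⟩ h₁ he
    simp only [Finset.mem_sigma, Finset.mem_filter, mem_goodSuffixes] at h h₁
    obtain ⟨hw, ⟨hC, hC2⟩, ⟨hC', hC2'⟩, hl⟩ := h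
    obtain ⟨hw₁, ⟨hC₁, hC2₁⟩, ⟨hC₁', hC2₁'⟩, hl₁⟩ := h₁
    obtain ⟨A, B, rfl, rfl⟩ := exists_append_of_suffix hC hC' hl
    obtain ⟨A₁, B₁, rfl, rfl⟩ := exists_append_of_suffix hC₁ hC₁' hl₁
    simp only [insertPair_append] at he
    have hn : ∀ {w}, w ∈ words r (m + 1) k → m ∉ w := fun hw h => by
      have := (le_of_mem_words hw h).1; omega
    have h := hn hw
    have h₁ := hn hw₁
    simp only [List.mem_append, not_or] at h h₁
    obtain ⟨rfl, he₂⟩ := append_cons_inj h.1 h₁.1 he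
    obtain ⟨rfl, rfl⟩ := append_cons_inj h.2.1 h₁.2.1 he₂
    rfl
  · intro v hv
    obtain ⟨A, B, C, rfl, hw, hBC, hC⟩ := exists_insert_of_mem_words hv
    refine ⟨⟨A ++ (B ++ C), C, B ++ C⟩, ?_, insertPair_append _ _ _ _⟩
    simp only [Finset.mem_sigma, Finset.mem_filter, mem_goodSuffixes]
    refine ⟨hw, ⟨?_, hC⟩, ⟨List.suffix_append _ _, hBC⟩, by simp⟩
    exact (List.suffix_append B C).trans (List.suffix_append A _)
  · intros; rfl

/-! ### Sums over ranks -/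

/-- The number of elements of `s` that are not longer than `C`. -/
def lengthRank (s : Finset (List ℕ)) (C : List ℕ) : ℕ :=
  (s.filter fun S => S.length ≤ C.length).card

theorem lengthRank_lt_iff {s : Finset (List ℕ)} {C C' : List ℕ} (hC' : C' ∈ s) :
    lengthRank s C < lengthRank s C' ↔ C.length < C'.length := by
  constructor
  · intro h
    by_contra hl
    refine absurd h (not_lt.2 (Finset.card_le_card fun S hS => ?_))
    simp only [Finset.mem_filter] at hS ⊢
    exact ⟨hS.1, by omega⟩
  · intro h
    refine Finset.card_lt_card ⟨fun S hS => ?_, fun hS => ?_⟩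
    · simp only [Finset.mem_filter] at hS ⊢
      exact ⟨hS.1, by omega⟩
    · have := hS (Finset.mem_filter.2 ⟨hC', le_rfl⟩)
      simp only [Finset.mem_filter] at this
      omega

theorem sum_lengthRank {M : Type*} [AddCommMonoid M] {s : Finset (List ℕ)}
    (hs : Set.InjOn List.length (s : Set (List ℕ))) (f : ℕ → M) :
    ∑ C ∈ s, f (lengthRank s C) = ∑ j ∈ Finset.range s.card, f (j + 1) := by
  have hinj : Set.InjOn (lengthRank s) (s : Set (List ℕ)) := by
    intro C hC C' hC' he
    refine hs hC hC' ?_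
    have h1 := (lengthRank_lt_iff (s := s) (C := C) hC').not
    have h2 := (lengthRank_lt_iff (s := s) (C := C') hC).not
    have := h1.1 (by omega)
    have := h2.1 (by omega)
    omega
  have himg : s.image (lengthRank s) = Finset.Ico 1 (s.card + 1) := by
    refine Finset.eq_of_subset_of_card_le (fun j hj => ?_) ?_
    · obtain ⟨C, hC, rfl⟩ := Finset.mem_image.1 hj
      refine Finset.mem_Ico.2 ⟨Finset.card_pos.2 ⟨C, Finset.mem_filter.2 ⟨hC, le_rfl⟩⟩, ?_⟩
      exact Nat.lt_succ_of_le (Finset.card_filter_le _ _)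
    · rw [Finset.card_image_of_injOn hinj]; simp
  rw [← Finset.sum_image (f := f) hinj, himg, Finset.sum_Ico_eq_sum_range]
  simp [add_comm]

theorem sum_lengthRank_pair {M : Type*} [AddCommMonoid M] {s : Finset (List ℕ)}
    (hs : Set.InjOn List.length (s : Set (List ℕ))) (g : ℕ → ℕ → M) :
    ∑ C ∈ s, ∑ C' ∈ s.filter (fun C' => C.length < C'.length),
        g (lengthRank s C) (lengthRank s C') =
      ∑ j ∈ Finset.range s.card, ∑ i ∈ (Finset.range s.card).filter (fun i => j < i),
        g (j + 1) (i + 1) := by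
  have h : ∀ C ∈ s, ∑ C' ∈ s.filter (fun C' => C.length < C'.length),
        g (lengthRank s C) (lengthRank s C') =
      ∑ i ∈ Finset.range s.card,
        if lengthRank s C < i + 1 then g (lengthRank s C) (i + 1) else 0 := by
    intro C _
    rw [Finset.sum_filter, ← sum_lengthRank hs
      (fun i => if lengthRank s C < i then g (lengthRank s C) i else 0)]
    exact Finset.sum_congr rfl fun C' hC' => by simp only [lengthRank_lt_iff hC']
  rw [Finset.sum_congr rfl h, sum_lengthRank hs (fun j => ∑ i ∈ Finset.range s.card,
    if j < i + 1 then g j (i + 1) else 0)]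
  refine Finset.sum_congr rfl fun j _ => ?_
  rw [Finset.sum_filter]
  simp only [Nat.add_lt_add_iff_right]

theorem injOn_length_goodSuffixes (r : ℕ → ℕ → Prop) (w : List ℕ) :
    Set.InjOn List.length (goodSuffixes r w : Set (List ℕ)) := by
  intro C hC C' hC' he
  exact (List.suffix_of_suffix_length_le (mem_goodSuffixes.1 hC).1 (mem_goodSuffixes.1 hC').1
    he.le).eq_of_length he

theorem sum_filter_length_le {M : Type*} [AddCommMonoid M] {s : Finset (List ℕ)}
    (hs : Set.InjOn List.length (s : Set (List ℕ))) {C : List ℕ} (hC : C ∈ s) (G : List ℕ → M) :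
    ∑ C' ∈ s.filter (fun C' => C.length ≤ C'.length), G C' =
      G C + ∑ C' ∈ s.filter (fun C' => C.length < C'.length), G C' := by
  rw [← Finset.sum_insert (by simp)]
  congr 1
  ext C'
  simp only [Finset.mem_filter, Finset.mem_insert]
  constructor
  · rintro ⟨h1, h2⟩
    rcases h2.eq_or_lt with h | h
    · exact Or.inl (hs h1 hC h.symm)
    · exact Or.inr ⟨h1, h⟩
  · rintro (rfl | ⟨h1, h2⟩)
    · exact ⟨hC, le_rfl⟩
    · exact ⟨h1, h2.le⟩

/-! ### The good suffixes after an insertion -/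

theorem suffix_append_cases {S A T : List ℕ} (h : S <:+ A ++ T) :
    S <:+ T ∨ ∃ A', A' <:+ A ∧ S = A' ++ T := by
  rcases le_total S.length T.length with hl | hl
  · exact Or.inl (List.suffix_of_suffix_length_le h (List.suffix_append A T) hl)
  · obtain ⟨A', rfl⟩ := List.suffix_of_suffix_length_le (List.suffix_append A T) h hl
    obtain ⟨t, ht⟩ := h
    rw [← List.append_assoc] at ht
    exact Or.inr ⟨A', ⟨t, List.append_cancel_right ht⟩, rfl⟩

theorem suffix_insert_cases {r : ℕ → ℕ → Prop} {m : ℕ} {A B C S : List ℕ}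
    (hm : m ∉ A ++ (B ++ C)) (hS : S <:+ A ++ m :: (B ++ m :: C)) (hg : GoodSuffix r S) :
    S <:+ C ∨ ∃ A', A' <:+ A ∧ S = A' ++ m :: (B ++ m :: C) := by
  simp only [List.mem_append, not_or] at hm
  have hBC : ∀ B', B' <:+ B → S ≠ B' ++ m :: C := by
    rintro B' hB' rfl
    have := hg.2 m (by simp)
    rw [List.count_append, List.count_cons_self, List.count_eq_zero.2 hm.2.2,
      List.count_eq_zero.2 fun h => hm.2.1 (hB'.subset h)] at this
    omega
  rcases suffix_append_cases hS with h | h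
  · rcases List.suffix_cons_iff.1 h with rfl | h
    · exact Or.inr ⟨[], List.nil_suffix, rfl⟩
    · rcases suffix_append_cases h with h | ⟨B', h1, h2⟩
      · rcases List.suffix_cons_iff.1 h with rfl | h
        · exact absurd rfl (hBC [] List.nil_suffix)
        · exact Or.inl h
      · exact absurd h2 (hBC B' h1)
  · exact Or.inr h

theorem mem_goodSuffixes_insert_of_suffix {r : ℕ → ℕ → Prop} {m : ℕ} {A B C S : List ℕ}
    (h : S <:+ C) : S ∈ goodSuffixes r (A ++ m :: (B ++ m :: C)) ↔
      S ∈ (goodSuffixes r (A ++ (B ++ C))).filter (fun S => S.length ≤ C.length) := by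
  have h1 : S <:+ A ++ m :: (B ++ m :: C) := h.trans ⟨A ++ m :: (B ++ [m]), by simp⟩
  have h2 : S <:+ A ++ (B ++ C) := h.trans ⟨A ++ B, by simp⟩
  simp [mem_goodSuffixes, h1, h2, h.length_le]

theorem suffix_of_mem_filter {r : ℕ → ℕ → Prop} {A B C S : List ℕ}
    (h : S ∈ (goodSuffixes r (A ++ (B ++ C))).filter (fun S => S.length ≤ C.length)) :
    S <:+ C := by
  simp only [Finset.mem_filter, mem_goodSuffixes] at h
  exact List.suffix_of_suffix_length_le h.1.1 ⟨A ++ B, by simp⟩ h.2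

/-- If the two new letters are not adjacent, or `r m c` holds for some letter `c` behind them, then
no good suffix contains them. -/
theorem goodSuffixes_insert_of_not_pairwise {r : ℕ → ℕ → Prop} {m : ℕ} {A B C : List ℕ}
    (hm : m ∉ A ++ (B ++ C)) (h : ¬ (m :: (B ++ m :: C)).Pairwise (fun b c => ¬ r b c)) :
    goodSuffixes r (A ++ m :: (B ++ m :: C)) =
      (goodSuffixes r (A ++ (B ++ C))).filter (fun S => S.length ≤ C.length) := by
  ext S
  constructor
  · intro hS
    obtain ⟨h1, h2⟩ := mem_goodSuffixes.1 hS
    rcases suffix_insert_cases hm h1 h2 with hSC | ⟨A', -, rfl⟩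
    · exact (mem_goodSuffixes_insert_of_suffix hSC).1 hS
    · exact absurd (List.pairwise_append.1 h2.1).2.1 h
  · intro hS
    exact (mem_goodSuffixes_insert_of_suffix (suffix_of_mem_filter hS)).2 hS

theorem not_pairwise_of_ne_nil {r : ℕ → ℕ → Prop} (hr : ∀ a b, a < b → r a b ∨ r b a) {m : ℕ}
    {B C : List ℕ} (hm : ∀ b ∈ B, m < b) (hB : B ≠ []) :
    ¬ (m :: (B ++ m :: C)).Pairwise (fun b c => ¬ r b c) := by
  intro h
  obtain ⟨b, hb⟩ := List.exists_mem_of_ne_nil B hB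
  rw [List.pairwise_cons, List.pairwise_append] at h
  rcases hr m b (hm b hb) with h1 | h1
  · exact h.1 b (by simp [hb]) h1
  · exact h.2.2.2 b hb m (by simp) h1

theorem goodSuffix_double {r : ℕ → ℕ → Prop} {m : ℕ} {C : List ℕ} (hC : GoodSuffix r C)
    (hm : m ∉ C) (h : ∀ c ∈ m :: C, ¬ r m c) : GoodSuffix r (m :: m :: C) := by
  refine ⟨?_, fun a ha => ?_⟩
  · simp only [List.pairwise_cons, List.mem_cons]
    simp only [List.mem_cons] at h
    exact ⟨fun c hc => h c (by tauto), fun c hc => h c (Or.inr hc), hC.1⟩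
  · by_cases ham : a = m
    · subst ham
      simp [List.count_eq_zero.2 hm]
    · have := hC.2 a (by simpa [ham] using ha)
      rw [List.count_cons_of_ne (Ne.symm ham), List.count_cons_of_ne (Ne.symm ham), this]

theorem goodSuffixes_insert_gt {m : ℕ} {A C : List ℕ}
    (hm : ∀ a ∈ A ++ C, m < a) (hC : GoodSuffix (· > ·) C) :
    goodSuffixes (· > ·) (A ++ m :: m :: C) =
      insert (m :: m :: C)
        ((goodSuffixes (· > ·) (A ++ C)).filter (fun S => S.length ≤ C.length)) := by
  have hm' : m ∉ A ++ ([] ++ C) := fun h => lt_irrefl _ (hm m h)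
  have hmC : m ∉ C := fun h => hm' (by simp [h])
  ext S
  rw [Finset.mem_insert]
  constructor
  · intro hS
    obtain ⟨h1, h2⟩ := mem_goodSuffixes.1 hS
    rcases suffix_insert_cases (B := []) hm' h1 h2 with hSC | ⟨A', hA', rfl⟩
    · exact Or.inr ((mem_goodSuffixes_insert_of_suffix (B := []) hSC).1 hS)
    · left
      rcases List.eq_nil_or_concat A' with rfl | ⟨t, a, rfl⟩
      · rfl
      · exfalso
        have := (List.pairwise_append.1 h2.1).2.2 a (by simp) m (by simp)
        exact this (hm a (List.mem_append_left _ (hA'.subset (by simp))))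
  · rintro (rfl | hS)
    · refine mem_goodSuffixes.2 ⟨List.suffix_append _ _, goodSuffix_double hC hmC ?_⟩
      intro c hc
      rcases List.mem_cons.1 hc with rfl | hc
      · exact lt_irrefl _
      · exact (hm c (by simp [hc])).not_gt
    · exact (mem_goodSuffixes_insert_of_suffix (B := []) 
        (suffix_of_mem_filter (B := []) hS)).2 hS

theorem goodSuffixes_insert_end_lt {m : ℕ} {A : List ℕ} (hm : ∀ a ∈ A, m < a) :
    goodSuffixes (· < ·) (A ++ [m, m]) =
      insert [] ((goodSuffixes (· < ·) A).image (fun S => S ++ [m, m])) := by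
  have hm' : m ∉ A ++ ([] ++ []) := fun h => lt_irrefl _ (hm m (by simpa using h))
  ext S
  rw [Finset.mem_insert, Finset.mem_image]
  constructor
  · intro hS
    obtain ⟨h1, h2⟩ := mem_goodSuffixes.1 hS
    rcases suffix_insert_cases (B := []) (C := []) hm' h1 h2 with hSC | ⟨A', hA', rfl⟩
    · exact Or.inl (List.suffix_nil.1 hSC)
    · refine Or.inr ⟨A', mem_goodSuffixes.2 ⟨hA', (List.pairwise_append.1 h2.1).1, ?_⟩, rfl⟩
      intro a ha
      have h3 := h2.2 a (by simp [ha])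
      have ham := hm a (hA'.subset ha)
      rw [List.count_append, List.count_eq_zero (l := m :: ([] ++ [m])).2 (by simp; omega)] at h3
      exact h3
  · rintro (rfl | ⟨A', hA', rfl⟩)
    · exact nil_mem_goodSuffixes _ _
    · obtain ⟨h1, h2⟩ := mem_goodSuffixes.1 hA'
      have hlt : ∀ a ∈ A', m < a := fun a ha => hm a (h1.subset ha)
      refine mem_goodSuffixes.2 ⟨?_, List.pairwise_append.2 ⟨h2.1, by simp, ?_⟩, ?_⟩
      · obtain ⟨t, rfl⟩ := h1
        exact ⟨t, by simp⟩
      · intro a ha b hb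
        have := hlt a ha
        simp at hb
        omega
      · intro a ha
        rw [List.count_append]
        by_cases ham : a = m
        · subst ham
          rw [List.count_eq_zero.2 fun h => lt_irrefl _ (hlt a h)]; simp
        · rw [h2.2 a (by simpa [ham] using ha), List.count_eq_zero.2 (by simpa using ham)]

/-! ### Adjacent pairs -/

/-- The number of pairs of adjacent letters of `w` that satisfy `p`. -/
def adjCount (p : ℕ → ℕ → Prop) [DecidableRel p] (w : List ℕ) : ℕ :=
  (w.zip w.tail).countP fun x => p x.1 x.2

/-- The contribution to `adjCount p (A ++ B)` of the pair formed by the last letter of `A` and the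
first letter of `B`; it is `0` if one of these does not exist. -/
def junction (p : ℕ → ℕ → Prop) [DecidableRel p] (A B : List ℕ) : ℕ :=
  match A.getLast?, B.head? with
  | some a, some b => if p a b then 1 else 0
  | _, _ => 0

section adj

variable (p : ℕ → ℕ → Prop) [DecidableRel p]

theorem adjCount_cons_cons (a b : ℕ) (l : List ℕ) :
    adjCount p (a :: b :: l) = (if p a b then 1 else 0) + adjCount p (b :: l) := by
  simp [adjCount, List.countP_cons, add_comm]

theorem adjCount_append (A B : List ℕ) :
    adjCount p (A ++ B) = adjCount p A + junction p A B + adjCount p B := by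
  induction A with
  | nil => simp [adjCount, junction]
  | cons a A ih =>
    cases A with
    | nil =>
      cases B with
      | nil => simp [adjCount, junction]
      | cons b B =>
        rw [List.singleton_append, adjCount_cons_cons]
        simp [adjCount, junction]
    | cons a' A =>
      rw [List.cons_append, List.cons_append, adjCount_cons_cons, ← List.cons_append, ih,
        adjCount_cons_cons]
      simp only [junction, List.getLast?_cons_cons]
      ring

variable {p}

theorem junction_eq_zero {A B : List ℕ} (h : ∀ a ∈ A, ∀ b ∈ B, ¬ p a b) : junction p A B = 0 := by
  unfold junction
  split
  · next a b ha hb => rw [if_neg (h a (List.mem_of_getLast? ha) b (List.mem_of_head? hb))]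
  · rfl

theorem junction_eq_one {A B : List ℕ} (hA : A ≠ []) (hB : B ≠ []) (h : ∀ a ∈ A, ∀ b ∈ B, p a b) :
    junction p A B = 1 := by
  obtain ⟨b, B, rfl⟩ := List.exists_cons_of_ne_nil hB
  rcases List.eq_nil_or_concat A with rfl | ⟨A, a, rfl⟩
  · exact absurd rfl hA
  · simpa [junction] using h a (by simp) b (by simp)

theorem junction_cons_right (A B C : List ℕ) (b : ℕ) :
    junction p A (b :: B) = junction p A (b :: C) := rfl

theorem junction_append_left (A : List ℕ) {B : List ℕ} (hB : B ≠ []) (C : List ℕ) :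
    junction p (A ++ B) C = junction p B C := by
  rcases List.eq_nil_or_concat B with rfl | ⟨B, b, rfl⟩
  · exact absurd rfl hB
  · simp [junction, List.getLast?_append]

theorem adjCount_cons (x : ℕ) (B : List ℕ) :
    adjCount p (x :: B) = junction p [x] B + adjCount p B := by
  rw [← List.singleton_append, adjCount_append]
  simp [adjCount]

end adj

theorem plat_insert {m : ℕ} {A B C : List ℕ} (hm : m ∉ A ++ (B ++ C))
    (hA : ∀ a ∈ A, a ∉ B ++ C) (hB : ∀ b ∈ B, b ∉ C) :
    plat (A ++ m :: (B ++ m :: C)) = plat (A ++ (B ++ C)) + if B = [] then 1 else 0 := by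
  change adjCount (· = ·) _ = adjCount (· = ·) _ + _
  simp only [List.mem_append, not_or] at hm
  have h1 : junction (· = ·) A (m :: (B ++ m :: C)) = 0 := by
    rw [junction_cons_right A _ [] m]
    exact junction_eq_zero (by rintro a ha b hb rfl; simp at hb; subst hb; exact hm.1 ha)
  have h2 : junction (· = ·) A (B ++ C) = 0 :=
    junction_eq_zero (by rintro a ha b hb rfl; exact hA a ha hb)
  have h3 : junction (· = ·) B C = 0 :=
    junction_eq_zero (by rintro a ha b hb rfl; exact hB a ha hb)
  have h4 : junction (· = ·) [m] C = 0 :=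
    junction_eq_zero (by rintro a ha b hb rfl; simp at ha; subst ha; exact hm.2.2 hb)
  rw [adjCount_append, adjCount_append, adjCount_append, adjCount_cons, h1, h2, h3]
  by_cases hBn : B = []
  · subst hBn
    rw [List.nil_append, adjCount_cons, h4]
    simp [junction, adjCount]
    ring
  · obtain ⟨b, B, rfl⟩ := List.exists_cons_of_ne_nil hBn
    have h5 : junction (· = ·) [m] (b :: B ++ m :: C) = 0 := by
      simp at hm
      simp [junction]
      tauto
    have h6 : junction (· = ·) (b :: B) (m :: C) = 0 := by
      rw [junction_cons_right _ _ [] m]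
      exact junction_eq_zero (by rintro a ha c hc rfl; simp at hc; subst hc; exact hm.2.1 ha)
    rw [adjCount_append, adjCount_cons m C, h4, h5, h6]
    simp

theorem not_mem_of_goodSuffix {r : ℕ → ℕ → Prop} {m k : ℕ} {A C : List ℕ}
    (hw : A ++ C ∈ words r m k) (hC : GoodSuffix r C) : ∀ a ∈ A, a ∉ C := by
  intro a ha haC
  have h1 := (le_of_mem_words hw (List.mem_append_left C ha)).2
  have h2 := hC.2 a haC
  have h3 := List.count_pos_iff.2 ha
  rw [List.count_append] at h1
  omega

/-- The plateaus created by an insertion: one if the two new letters are adjacent, and none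
otherwise. -/
theorem plat_insert_words {r : ℕ → ℕ → Prop} {m k : ℕ} {A B C : List ℕ}
    (hw : A ++ (B ++ C) ∈ words r (m + 1) k) (hBC : GoodSuffix r (B ++ C)) (hC : GoodSuffix r C) :
    plat (A ++ m :: (B ++ m :: C)) = plat (A ++ (B ++ C)) + if B = [] then 1 else 0 := by
  refine plat_insert (fun h => ?_) (not_mem_of_goodSuffix hw hBC) fun b hb => ?_
  · have := (le_of_mem_words hw h).1
    omega
  · rw [← List.append_assoc] at hw
    exact not_mem_of_goodSuffix hw hC b (by simp [hb])

/-! ### The plateau recursion -/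

/-- Separates, in `sum_words_succ`, the insertions of two adjacent letters from the others. -/
theorem sum_words_succ_split {M : Type*} [AddCommMonoid M] (r : ℕ → ℕ → Prop) (m k : ℕ)
    (G : List ℕ → M) :
    ∑ v ∈ words r m (k + 1), G v =
      ∑ w ∈ words r (m + 1) k, (∑ C ∈ goodSuffixes r w, G (insertPair m w C C) +
        ∑ C ∈ goodSuffixes r w, ∑ C' ∈ (goodSuffixes r w).filter (fun C' => C.length < C'.length),
          G (insertPair m w C' C)) := by
  rw [sum_words_succ]
  refine Finset.sum_congr rfl fun w _ => ?_
  rw [← Finset.sum_add_distrib]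
  exact Finset.sum_congr rfl fun C hC =>
    sum_filter_length_le (injOn_length_goodSuffixes r w) hC _

theorem exists_append_of_mem_goodSuffixes {r : ℕ → ℕ → Prop} {w C C' : List ℕ}
    (hC : C ∈ goodSuffixes r w) (hC' : C' ∈ goodSuffixes r w) (hl : C.length ≤ C'.length) :
    ∃ A B, w = A ++ (B ++ C) ∧ C' = B ++ C ∧ GoodSuffix r (B ++ C) ∧ GoodSuffix r C := by
  obtain ⟨h1, h2⟩ := mem_goodSuffixes.1 hC
  obtain ⟨h1', h2'⟩ := mem_goodSuffixes.1 hC'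
  obtain ⟨A, B, rfl, rfl⟩ := exists_append_of_suffix h1 h1' hl
  exact ⟨A, B, rfl, rfl, h2', h2⟩

theorem lt_of_mem_words {r : ℕ → ℕ → Prop} {m k : ℕ} {w : List ℕ} (hw : w ∈ words r (m + 1) k) :
    ∀ a ∈ w, m < a := fun _ ha => (le_of_mem_words hw ha).1

theorem not_mem_of_mem_words {r : ℕ → ℕ → Prop} {m k : ℕ} {w : List ℕ}
    (hw : w ∈ words r (m + 1) k) : m ∉ w := fun h => lt_irrefl _ (lt_of_mem_words hw m h)

theorem card_goodSuffixes_insert_of_lt {r : ℕ → ℕ → Prop} (hr : ∀ a b, a < b → r a b ∨ r b a)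
    {m k : ℕ} {w C C' : List ℕ} (hw : w ∈ words r (m + 1) k) (hC : C ∈ goodSuffixes r w)
    (hC' : C' ∈ goodSuffixes r w) (hl : C.length < C'.length) :
    (goodSuffixes r (insertPair m w C' C)).card = lengthRank (goodSuffixes r w) C := by
  obtain ⟨A, B, rfl, rfl, h1, h2⟩ := exists_append_of_mem_goodSuffixes hC hC' hl.le
  rw [insertPair_append, goodSuffixes_insert_of_not_pairwise (not_mem_of_mem_words hw)]
  · rfl
  · refine not_pairwise_of_ne_nil hr (fun b hb => lt_of_mem_words hw b (by simp [hb])) ?_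
    rintro rfl
    simp at hl

theorem card_goodSuffixes_insert_gt {m k : ℕ} {w C : List ℕ} (hw : w ∈ words (· > ·) (m + 1) k)
    (hC : C ∈ goodSuffixes (· > ·) w) :
    (goodSuffixes (· > ·) (insertPair m w C C)).card =
      lengthRank (goodSuffixes (· > ·) w) C + 1 := by
  obtain ⟨⟨A, rfl⟩, h2⟩ := mem_goodSuffixes.1 hC
  rw [show insertPair m (A ++ C) C C = A ++ m :: m :: C by
    simpa using insertPair_append m A [] C,
    goodSuffixes_insert_gt (lt_of_mem_words hw) h2, Finset.card_insert_of_notMem]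
  · rfl
  · simp

theorem lengthRank_nil (r : ℕ → ℕ → Prop) (w : List ℕ) :
    lengthRank (goodSuffixes r w) [] = 1 := by
  refine Finset.card_eq_one.2 ⟨[], Finset.ext fun S => ?_⟩
  simp only [Finset.mem_filter, List.length_nil, Nat.le_zero, List.length_eq_zero_iff,
    Finset.mem_singleton]
  exact ⟨fun h => h.2, by rintro rfl; exact ⟨nil_mem_goodSuffixes _ _, rfl⟩⟩

theorem card_goodSuffixes_insert_lt {m k : ℕ} {w C : List ℕ} (hw : w ∈ words (· < ·) (m + 1) k)
    (hC : C ∈ goodSuffixes (· < ·) w) :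
    (goodSuffixes (· < ·) (insertPair m w C C)).card =
      if lengthRank (goodSuffixes (· < ·) w) C = 1 then (goodSuffixes (· < ·) w).card + 1
      else lengthRank (goodSuffixes (· < ·) w) C := by
  by_cases hn : C = []
  · subst hn
    rw [if_pos (lengthRank_nil _ _), show insertPair m w [] [] = w ++ [m, m] by
      simpa using insertPair_append m w [] [], goodSuffixes_insert_end_lt (lt_of_mem_words hw),
      Finset.card_insert_of_notMem (by simp),
      Finset.card_image_of_injective _ (List.append_left_injective _)]
  · have hlt : lengthRank (goodSuffixes (· < ·) w) [] < lengthRank (goodSuffixes (· < ·) w) C :=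
      (lengthRank_lt_iff hC).2 (List.length_pos_iff.2 hn)
    rw [lengthRank_nil] at hlt
    rw [if_neg (by omega)]
    obtain ⟨⟨A, rfl⟩, h2⟩ := mem_goodSuffixes.1 hC
    rw [show insertPair m (A ++ C) C C = A ++ m :: ([] ++ m :: C) by
      simpa using insertPair_append m A [] C,
      goodSuffixes_insert_of_not_pairwise (B := []) (not_mem_of_mem_words hw)]
    · rfl
    · intro h
      obtain ⟨c, hc⟩ := List.exists_mem_of_ne_nil C hn
      exact (List.pairwise_cons.1 h).1 c (by simp [hc]) (lt_of_mem_words hw c (by simp [hc]))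

/-- One step of the generating tree common to the patterns `132` and `123`: the weighted sum of
`f` over the labels of the children of a node with label `k`, where `q` marks a new plateau. -/
def platStep {R : Type*} [CommRing R] (q : R) (f : ℕ → R) (k : ℕ) : R :=
  q * ∑ j ∈ Finset.range k, f (j + 2) +
    ∑ j ∈ Finset.range k, ∑ _i ∈ (Finset.range k).filter (fun i => j < i), f (j + 1)

theorem sum_plat_succ {R : Type*} [CommRing R] (q : R) {r : ℕ → ℕ → Prop}
    (hr : ∀ a b, a < b → r a b ∨ r b a) (m k : ℕ) (f : ℕ → R) (g : ℕ → ℕ → ℕ)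
    (hg : ∀ w ∈ words r (m + 1) k, ∀ C ∈ goodSuffixes r w,
      (goodSuffixes r (insertPair m w C C)).card =
        g (goodSuffixes r w).card (lengthRank (goodSuffixes r w) C))
    (hs : ∀ c, ∑ j ∈ Finset.range (c + 1), f (g (c + 1) (j + 1)) =
      ∑ j ∈ Finset.range (c + 1), f (j + 2)) :
    ∑ v ∈ words r m (k + 1), q ^ plat v * f (goodSuffixes r v).card =
      ∑ w ∈ words r (m + 1) k, q ^ plat w * platStep q f (goodSuffixes r w).card := by
  rw [sum_words_succ_split]
  refine Finset.sum_congr rfl fun w hw => ?_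
  have hinj := injOn_length_goodSuffixes r w
  rw [platStep, mul_add]
  congr 1
  · obtain ⟨c, hc⟩ := Nat.exists_eq_succ_of_ne_zero
      (Finset.card_ne_zero_of_mem (nil_mem_goodSuffixes r w))
    have h1 : ∑ j ∈ Finset.range (goodSuffixes r w).card, f (j + 2) =
        ∑ C ∈ goodSuffixes r w, f (g (goodSuffixes r w).card (lengthRank (goodSuffixes r w) C)) := by
      rw [sum_lengthRank hinj (fun j => f (g (goodSuffixes r w).card j)), hc]
      exact (hs c).symm
    rw [h1, ← mul_assoc, Finset.mul_sum]
    refine Finset.sum_congr rfl fun C hC => ?_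
    rw [hg w hw C hC]
    obtain ⟨⟨A, rfl⟩, h2⟩ := mem_goodSuffixes.1 hC
    have h3 := plat_insert_words (B := []) hw h2 h2
    rw [show insertPair m (A ++ C) C C = A ++ m :: ([] ++ m :: C) by
      simpa using insertPair_append m A [] C, h3]
    simp [pow_succ]
  · rw [← sum_lengthRank_pair hinj (fun j _ => f j), Finset.mul_sum]
    refine Finset.sum_congr rfl fun C hC => ?_
    rw [Finset.mul_sum]
    refine Finset.sum_congr rfl fun C' hC' => ?_
    obtain ⟨hC', hl⟩ := Finset.mem_filter.1 hC'
    rw [card_goodSuffixes_insert_of_lt hr hw hC hC' hl]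
    obtain ⟨A, B, rfl, rfl, h1, h2⟩ := exists_append_of_mem_goodSuffixes hC hC' hl.le
    rw [insertPair_append, plat_insert_words hw h1 h2, if_neg]
    · simp
    · rintro rfl
      simp at hl

theorem sum_plat_succ_gt {R : Type*} [CommRing R] (q : R) (m k : ℕ) (f : ℕ → R) :
    ∑ v ∈ words (· > ·) m (k + 1), q ^ plat v * f (goodSuffixes (· > ·) v).card =
      ∑ w ∈ words (· > ·) (m + 1) k, q ^ plat w * platStep q f (goodSuffixes (· > ·) w).card :=
  sum_plat_succ q (fun _ _ h => Or.inr h) m k f (fun _ j => j + 1)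
    (fun _ hw _ hC => card_goodSuffixes_insert_gt hw hC) fun _ => rfl

theorem sum_plat_succ_lt {R : Type*} [CommRing R] (q : R) (m k : ℕ) (f : ℕ → R) :
    ∑ v ∈ words (· < ·) m (k + 1), q ^ plat v * f (goodSuffixes (· < ·) v).card =
      ∑ w ∈ words (· < ·) (m + 1) k, q ^ plat w * platStep q f (goodSuffixes (· < ·) w).card := by
  refine sum_plat_succ q (fun _ _ h => Or.inl h) m k f (fun c j => if j = 1 then c + 1 else j)
    (fun _ hw _ hC => card_goodSuffixes_insert_lt hw hC) fun c => ?_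
  rw [Finset.sum_range_succ', Finset.sum_range_succ]
  simp

/-- Plateaus and numbers of good suffixes are jointly equidistributed over the `132`-avoiding and
the `123`-avoiding Stirling words. -/
theorem sum_plat_gt_eq_lt {R : Type*} [CommRing R] (q : R) (k m : ℕ) (f : ℕ → R) :
    ∑ v ∈ words (· > ·) m k, q ^ plat v * f (goodSuffixes (· > ·) v).card =
      ∑ v ∈ words (· < ·) m k, q ^ plat v * f (goodSuffixes (· < ·) v).card := by
  induction k generalizing m f with
  | zero =>
    have h : ∀ r, (goodSuffixes r []).card = 1 := fun r =>
      Finset.card_eq_one.2 ⟨[], Finset.ext fun S => by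
        rw [Finset.mem_singleton]
        exact ⟨fun h => List.suffix_nil.1 (mem_goodSuffixes.1 h).1,
          by rintro rfl; exact nil_mem_goodSuffixes _ _⟩⟩
    simp [words_zero, h]
  | succ k ih => rw [sum_plat_succ_gt, sum_plat_succ_lt, ih]

/-! ### The descent recursion -/

/-- Inserting a letter smaller than all the others between `A` and `C` creates no new descent at
its left: either there is nothing to its left, or the last letter of `A` begins a descent already. -/
def FreeGap (A C : List ℕ) : Prop := A = [] ∨ junction (· > ·) A C = 1

open Classical in
/-- Whether some good suffix of `w` (for the pattern `132`) is preceded by a free gap. -/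
noncomputable def hasFreeGap (w : List ℕ) : Bool :=
  decide (∃ A C, w = A ++ C ∧ GoodSuffix (· > ·) C ∧ FreeGap A C)

theorem junction_gt_eq_zero {A C : List ℕ} (h : (A ++ C).Pairwise (fun b c => ¬ b > c)) :
    junction (· > ·) A C = 0 :=
  junction_eq_zero fun a ha c hc => (List.pairwise_append.1 h).2.2 a ha c hc

/-- A free gap can only precede the longest good suffix, because a gap within a weakly increasing
suffix is not free. -/
theorem freeGap_iff {w A C : List ℕ} (hw : w = A ++ C) (hC : GoodSuffix (· > ·) C) :
    FreeGap A C ↔ hasFreeGap w = true ∧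
      lengthRank (goodSuffixes (· > ·) w) C = (goodSuffixes (· > ·) w).card := by
  have key : ∀ A C, w = A ++ C → GoodSuffix (· > ·) C → FreeGap A C →
      lengthRank (goodSuffixes (· > ·) w) C = (goodSuffixes (· > ·) w).card := by
    intro A C hw _ hf
    unfold lengthRank
    rw [Finset.filter_true_of_mem]
    intro S hS
    by_contra hl
    push Not at hl
    obtain ⟨hS1, hS2⟩ := mem_goodSuffixes.1 hS
    obtain ⟨A', B, h1, rfl⟩ := exists_append_of_suffix (hw ▸ List.suffix_append A C) hS1 hl.le
    have hB : B ≠ [] := by rintro rfl; simp at hl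
    have hA : A = A' ++ B := by
      rw [h1, ← List.append_assoc] at hw
      exact (List.append_cancel_right hw).symm
    rcases hf with rfl | hf
    · simp [hB] at hA
    · rw [hA, junction_append_left _ hB, junction_gt_eq_zero hS2.1] at hf
      exact absurd hf (by simp)
  constructor
  · intro hf
    exact ⟨by simpa [hasFreeGap] using ⟨A, C, hw, hC, hf⟩, key A C hw hC hf⟩
  · rintro ⟨h1, h2⟩
    obtain ⟨A₁, C₁, hw₁, hC₁, hf₁⟩ : ∃ A C, w = A ++ C ∧ GoodSuffix (· > ·) C ∧ FreeGap A C := by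
      simpa [hasFreeGap] using h1
    have h3 := key A₁ C₁ hw₁ hC₁ hf₁
    have hm : C ∈ goodSuffixes (· > ·) w := mem_goodSuffixes.2 ⟨⟨A, hw.symm⟩, hC⟩
    have hm₁ : C₁ ∈ goodSuffixes (· > ·) w := mem_goodSuffixes.2 ⟨⟨A₁, hw₁.symm⟩, hC₁⟩
    have h4 := (lengthRank_lt_iff (C := C) hm₁).not
    have h5 := (lengthRank_lt_iff (C := C₁) hm).not
    have h6 := h4.1 (by omega)
    have h7 := h5.1 (by omega)
    obtain rfl : C = C₁ := injOn_length_goodSuffixes _ _ hm hm₁ (by omega)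
    obtain rfl : A = A₁ := List.append_cancel_right (hw ▸ hw₁)
    exact hf₁

open Classical in
/-- The descents created by an insertion: one before the first of the new letters unless the gap
is free, and one before the second unless the new letters are adjacent. -/
theorem des_insert {m : ℕ} {A B C : List ℕ} (hm : ∀ a ∈ A ++ (B ++ C), m < a)
    (hBC : GoodSuffix (· > ·) (B ++ C)) :
    des (A ++ m :: (B ++ m :: C)) = des (A ++ (B ++ C)) +
      ((if FreeGap A (B ++ C) then 0 else 1) + if B = [] then 0 else 1) := by
  change adjCount (· > ·) _ = adjCount (· > ·) _ + _
  have h0 : ∀ D, (∀ d ∈ D, m ≤ d) → junction (· > ·) [m] D = 0 := fun D hD =>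
    junction_eq_zero (by simpa using hD)
  have h1 : ∀ D D' : List ℕ, (∀ d ∈ D, m < d) →
      junction (· > ·) D (m :: D') = if D = [] then 0 else 1 := by
    intro D D' hD
    split_ifs with h
    · subst h; simp [junction]
    · rw [junction_cons_right _ _ [] m]
      exact junction_eq_one h (by simp) (by simpa using hD)
  have hA : ∀ a ∈ A, m < a := fun a ha => hm a (by simp [ha])
  have hB : ∀ a ∈ B, m < a := fun a ha => hm a (by simp [ha])
  have hC : ∀ a ∈ C, m < a := fun a ha => hm a (by simp [ha])
  have hle : ∀ d ∈ B ++ m :: C, m ≤ d := by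
    intro d hd
    rcases List.mem_append.1 hd with hd | hd
    · exact (hB d hd).le
    · rcases List.mem_cons.1 hd with rfl | hd
      · exact le_rfl
      · exact (hC d hd).le
  have hf : (if A = [] then 0 else 1) =
      junction (· > ·) A (B ++ C) + if FreeGap A (B ++ C) then 0 else 1 := by
    by_cases hAn : A = []
    · subst hAn
      simp [FreeGap, show junction (· > ·) [] (B ++ C) = 0 from rfl]
    have hj : junction (· > ·) A (B ++ C) = 0 ∨ junction (· > ·) A (B ++ C) = 1 := by
      unfold junction
      split
      · split_ifs <;> simp
      · simp
    unfold FreeGap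
    rcases hj with hj | hj <;> simp [hj, hAn]
  rw [adjCount_append, adjCount_append, adjCount_append, adjCount_cons m (B ++ m :: C),
    adjCount_append, adjCount_cons m C, h0 C fun c hc => (hC c hc).le, h0 _ hle, h1 A _ hA,
    h1 B _ hB, junction_gt_eq_zero hBC.1, hf]
  ring

theorem hasFreeGap_double {m : ℕ} {A C : List ℕ} (hm : ∀ a ∈ A ++ C, m < a)
    (hC : GoodSuffix (· > ·) C) : hasFreeGap (A ++ m :: m :: C) = true := by
  have h : m :: m :: C ∈ goodSuffixes (· > ·) (A ++ m :: m :: C) := by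
    rw [goodSuffixes_insert_gt hm hC]
    simp
  have : ∃ A' C', A ++ m :: m :: C = A' ++ C' ∧ GoodSuffix (· > ·) C' ∧ FreeGap A' C' := by
    refine ⟨A, m :: m :: C, rfl, (mem_goodSuffixes.1 h).2, ?_⟩
    by_cases hA : A = []
    · exact Or.inl hA
    · right
      rw [junction_cons_right _ _ [] m]
      exact junction_eq_one hA (by simp) (by simpa using fun a ha => hm a (by simp [ha]))
  simpa [hasFreeGap] using this

theorem hasFreeGap_of_ne_nil {m : ℕ} {A B C : List ℕ} (hm : ∀ a ∈ A ++ (B ++ C), m < a)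
    (hC : GoodSuffix (· > ·) C) (hB : B ≠ []) :
    hasFreeGap (A ++ m :: (B ++ m :: C)) = false := by
  have hm' : m ∉ A ++ (B ++ C) := fun h => lt_irrefl _ (hm m h)
  have : ¬ ∃ A' C', A ++ m :: (B ++ m :: C) = A' ++ C' ∧ GoodSuffix (· > ·) C' ∧
      FreeGap A' C' := by
    rintro ⟨A', S, he, hS, hf⟩
    have hSm : S ∈ goodSuffixes (· > ·) (A ++ m :: (B ++ m :: C)) :=
      mem_goodSuffixes.2 ⟨⟨A', he.symm⟩, hS⟩
    rw [goodSuffixes_insert_of_not_pairwise hm'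
      (not_pairwise_of_ne_nil (fun _ _ h => Or.inr h) (fun b hb => hm b (by simp [hb])) hB)] at hSm
    obtain ⟨T, rfl⟩ := suffix_of_mem_filter hSm
    have hA' : A' = (A ++ m :: B) ++ m :: T := by
      refine List.append_cancel_right (bs := S) ?_
      rw [← he]
      simp
    subst hA'
    rcases hf with hf | hf
    · simp at hf
    · rw [junction_append_left _ (by simp), junction_gt_eq_zero] at hf
      · exact absurd hf (by simp)
      · rw [List.cons_append, List.pairwise_cons]
        exact ⟨fun c hc => (hm c (by simp at hc ⊢; tauto)).not_gt, hC.1⟩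
  simpa [hasFreeGap] using this

section

variable {R : Type*} [CommRing R]

/-- The weight of the descent before the first new letter, if this letter is inserted at the gap
with index `i` among `k` ones and `t` tells whether the last gap is free. -/
def gapWeight (q : R) (t : Bool) (k i : ℕ) : R := if t = true ∧ i + 1 = k then 1 else q

/-- One step of the generating tree for the pattern `132`: the weighted sum of `f` over the labels
of the children of a node with label `(k, t)`, where `q` marks a new descent. -/
def desStep (q : R) (f : ℕ → Bool → R) (k : ℕ) (t : Bool) : R :=
  ∑ j ∈ Finset.range k, gapWeight q t k j * f (j + 2) true +
    ∑ j ∈ Finset.range k, ∑ i ∈ (Finset.range k).filter (fun i => j < i),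
      q * gapWeight q t k i * f (j + 1) false

theorem pow_des_insert (q : R) {m k : ℕ} {A B C : List ℕ}
    (hw : A ++ (B ++ C) ∈ words (· > ·) (m + 1) k) (hBC : GoodSuffix (· > ·) (B ++ C)) :
    q ^ des (A ++ m :: (B ++ m :: C)) = q ^ des (A ++ (B ++ C)) *
      ((if B = [] then 1 else q) *
        gapWeight q (hasFreeGap (A ++ (B ++ C))) (goodSuffixes (· > ·) (A ++ (B ++ C))).card
          (lengthRank (goodSuffixes (· > ·) (A ++ (B ++ C))) (B ++ C) - 1)) := by
  classical
  have hmem : B ++ C ∈ goodSuffixes (· > ·) (A ++ (B ++ C)) :=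
    mem_goodSuffixes.2 ⟨List.suffix_append _ _, hBC⟩
  have hpos : 0 < lengthRank (goodSuffixes (· > ·) (A ++ (B ++ C))) (B ++ C) :=
    Finset.card_pos.2 ⟨B ++ C, Finset.mem_filter.2 ⟨hmem, le_rfl⟩⟩
  rw [des_insert (lt_of_mem_words hw) hBC, pow_add, gapWeight, Nat.sub_add_cancel hpos]
  have hf := freeGap_iff (A := A) rfl hBC
  simp only [← hf]
  split_ifs <;> simp [pow_succ]

theorem sum_des_succ (q : R) (m k : ℕ) (f : ℕ → Bool → R) :
    ∑ v ∈ words (· > ·) m (k + 1),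
        q ^ des v * f (goodSuffixes (· > ·) v).card (hasFreeGap v) =
      ∑ w ∈ words (· > ·) (m + 1) k,
        q ^ des w * desStep q f (goodSuffixes (· > ·) w).card (hasFreeGap w) := by
  rw [sum_words_succ_split]
  refine Finset.sum_congr rfl fun w hw => ?_
  have hinj := injOn_length_goodSuffixes (· > ·) w
  rw [desStep, mul_add]
  congr 1
  · have h := sum_lengthRank hinj (fun j => gapWeight q (hasFreeGap w)
      (goodSuffixes (· > ·) w).card (j - 1) * f (j + 1) true)
    simp only [Nat.add_sub_cancel] at h
    rw [← h, Finset.mul_sum]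
    refine Finset.sum_congr rfl fun C hC => ?_
    rw [card_goodSuffixes_insert_gt hw hC]
    obtain ⟨⟨A, rfl⟩, h2⟩ := mem_goodSuffixes.1 hC
    have h3 := pow_des_insert q (B := []) hw h2
    rw [show insertPair m (A ++ C) C C = A ++ m :: ([] ++ m :: C) by
      simpa using insertPair_append m A [] C, h3]
    simp only [List.nil_append, if_true, one_mul]
    rw [hasFreeGap_double (lt_of_mem_words hw) h2, mul_assoc]
  · have h := sum_lengthRank_pair hinj (fun j i => q * gapWeight q (hasFreeGap w)
      (goodSuffixes (· > ·) w).card (i - 1) * f j false)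
    simp only [Nat.add_sub_cancel] at h
    rw [← h, Finset.mul_sum]
    refine Finset.sum_congr rfl fun C hC => ?_
    rw [Finset.mul_sum]
    refine Finset.sum_congr rfl fun C' hC' => ?_
    obtain ⟨hC', hl⟩ := Finset.mem_filter.1 hC'
    rw [card_goodSuffixes_insert_of_lt (fun _ _ h => Or.inr h) hw hC hC' hl]
    obtain ⟨A, B, rfl, rfl, h1, h2⟩ := exists_append_of_mem_goodSuffixes hC hC' hl.le
    have hB : B ≠ [] := by rintro rfl; simp at hl
    rw [insertPair_append, pow_des_insert q hw h1, if_neg hB,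
      hasFreeGap_of_ne_nil (lt_of_mem_words hw) h2 hB, mul_assoc]

end

/-! ### Lagrange inversion -/

section Lagrange

open PowerSeries

variable {R : Type*} [CommRing R]

theorem aeval_sub_dvd (p : Polynomial R) (v w : R⟦X⟧) :
    v - w ∣ Polynomial.aeval v p - Polynomial.aeval w p := by
  rw [← Polynomial.eval_map_algebraMap, ← Polynomial.eval_map_algebraMap]
  exact Polynomial.sub_dvd_eval_sub v w _

/-- The equation `w = X * φ(w)` is solvable in formal power series: the solution is the limit of
the iteration `v ↦ X * φ(v)`, each step of which makes one more coefficient stationary. -/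
theorem exists_eq_X_mul_aeval (φ : Polynomial R) :
    ∃ w : R⟦X⟧, w = X * Polynomial.aeval w φ := by
  let F : R⟦X⟧ → R⟦X⟧ := fun v => X * Polynomial.aeval v φ
  have hF : ∀ n v w, X ^ n ∣ v - w → X ^ (n + 1) ∣ F v - F w := by
    intro n v w h
    have := mul_dvd_mul_left (X : R⟦X⟧) (h.trans (aeval_sub_dvd φ v w))
    rwa [← pow_succ', mul_sub] at this
  have hstep : ∀ n, X ^ n ∣ F^[n + 1] 0 - F^[n] 0 := by
    intro n
    induction n with
    | zero => simp
    | succ n ih =>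
      rw [Function.iterate_succ_apply' F (n + 1), Function.iterate_succ_apply' F n]
      rw [Function.iterate_succ_apply' F n] at ih
      exact hF n _ _ ih
  have hle : ∀ n k, X ^ n ∣ F^[n + k] 0 - F^[n] 0 := by
    intro n k
    induction k with
    | zero => simp
    | succ k ih =>
      have := ((pow_dvd_pow X (Nat.le_add_right n k)).trans (hstep (n + k))).add ih
      rwa [sub_add_sub_cancel] at this
  let w : R⟦X⟧ := mk fun n => coeff n (F^[n + 1] 0)
  have hw : ∀ n, X ^ n ∣ w - F^[n] 0 := by
    intro n
    rw [X_pow_dvd_iff]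
    intro i hi
    obtain ⟨k, rfl⟩ := Nat.exists_eq_add_of_le (Nat.succ_le_of_lt hi)
    have := X_pow_dvd_iff.1 (hle (i + 1) k) i (Nat.lt_succ_self i)
    rw [map_sub, sub_eq_zero] at this
    rw [map_sub, this, coeff_mk, sub_self]
  refine ⟨w, sub_eq_zero.1 (PowerSeries.ext fun n => ?_)⟩
  have h1 : X ^ (n + 1) ∣ w - F w := by
    have := (hw (n + 1)).sub (hF n _ _ (hw n))
    rwa [Function.iterate_succ_apply', sub_sub_sub_cancel_right] at this
  simpa using X_pow_dvd_iff.1 h1 n (Nat.lt_succ_self n)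

theorem constantCoeff_aeval {w : R⟦X⟧} (hw : constantCoeff w = 0) (p : Polynomial R) :
    constantCoeff (Polynomial.aeval w p) = p.coeff 0 := by
  rw [Polynomial.aeval_def, Polynomial.hom_eval₂, hw, Polynomial.eval₂_at_zero]
  simp

/-- Lagrange inversion. By linearity `H = t ^ k`; then `w ^ k = X ^ k * φ(w) ^ k` reduces the
coefficient of `w ^ k` at `n` to that of `φ(w) ^ k` at `n - k`. -/
theorem lagrange_inversion [IsDomain R] [CharZero R] {φ : Polynomial R} {w : R⟦X⟧}
    (hw : w = X * Polynomial.aeval w φ) (n : ℕ) (H : Polynomial R) :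
    ((n + 1 : ℕ) : R) * coeff (n + 1) (Polynomial.aeval w H) =
      (Polynomial.derivative H * φ ^ (n + 1)).coeff n := by
  have hX : X ∣ w := ⟨_, hw⟩
  have hw0 : constantCoeff w = 0 := X_dvd_iff.1 hX
  induction n using Nat.strong_induction_on generalizing H with
  | _ n ih =>
  induction H using Polynomial.induction_on' with
  | add p q hp hq => simp only [map_add, mul_add, hp, hq, add_mul,
      Polynomial.coeff_add]
  | monomial k a =>
    rw [Polynomial.derivative_monomial, Polynomial.aeval_monomial,
      ← Polynomial.C_mul_X_pow_eq_monomial, mul_assoc, Polynomial.coeff_C_mul]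
    have hal : (algebraMap R R⟦X⟧) a = C a := rfl
    rw [hal, coeff_C_mul]
    rcases Nat.eq_zero_or_pos k with rfl | hk
    · simp [coeff_one]
    rw [mul_left_comm, mul_assoc]
    congr 1
    rw [Polynomial.coeff_X_pow_mul']
    rcases Nat.lt_or_ge (n + 1) k with hnk | hnk
    · rw [if_neg (by omega), X_pow_dvd_iff.1 (pow_dvd_pow_of_dvd hX k) _ hnk]
      simp
    rw [if_pos (by omega)]
    obtain ⟨d, hd⟩ := Nat.exists_eq_add_of_le' hnk
    have hwk : coeff (n + 1) (w ^ k) = coeff d (Polynomial.aeval w (φ ^ k)) := by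
      conv_lhs => rw [hw]
      rw [mul_pow, hd, coeff_X_pow_mul, ← map_pow]
    rw [hwk, show n - (k - 1) = d by omega]
    rcases Nat.eq_zero_or_pos d with rfl | hdpos
    · rw [coeff_zero_eq_constantCoeff_apply, constantCoeff_aeval hw0,
        show k = n + 1 by omega]
    · obtain ⟨e, rfl⟩ := Nat.exists_eq_succ_of_ne_zero hdpos.ne'
      have h1 := ih e (by omega) (φ ^ k)
      have h2 : Polynomial.C ((n + 1 : ℕ) : R) *
          (Polynomial.derivative (φ ^ k) * φ ^ (e + 1)) =
          Polynomial.C (k : R) * Polynomial.derivative (φ ^ (n + 1)) := by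
        rw [Polynomial.derivative_pow, Polynomial.derivative_pow,
          show n + 1 - 1 = (k - 1) + (e + 1) by omega, pow_add]
        ring
      have h3 := congrArg (fun p => Polynomial.coeff p e) h2
      simp only [Polynomial.coeff_C_mul, Polynomial.coeff_derivative] at h3
      rw [← h1] at h3
      have hne : ((e + 1 : ℕ) : R) ≠ 0 := Nat.cast_ne_zero.2 (Nat.succ_ne_zero e)
      refine mul_left_cancel₀ hne ?_
      rw [mul_left_comm, Nat.succ_eq_add_one, h3]
      push_cast
      ring

end Lagrange

/-! ### The descent generating function -/

section

open PowerSeries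

variable {R : Type*} [CommRing R]

theorem sum_Ico_coeff_pow {u I : R⟦X⟧} (hu : X ∣ u) (hI : (1 - u) * I = 1) (g : R⟦X⟧)
    {j n : ℕ} (hj : j ≤ n + 1) :
    ∑ h ∈ Finset.Ico j (n + 1), coeff n (g * u ^ h) = coeff n (g * u ^ j * I) := by
  have h1 : ∑ h ∈ Finset.Ico j (n + 1), u ^ h = (u ^ j - u ^ (n + 1)) * I := by
    rw [← geom_sum_Ico_mul_neg u hj, mul_assoc, hI, mul_one]
  have h2 : coeff n (g * u ^ (n + 1) * I) = 0 :=
    X_pow_dvd_iff.1 (((pow_dvd_pow_of_dvd hu (n + 1)).mul_left g).mul_right I) n (by omega)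
  rw [← map_sum, ← Finset.mul_sum, h1, ← mul_assoc, mul_sub, sub_mul, map_sub, h2, sub_zero]

/-- The functional that `desStep` advances: the coefficient of `X ^ n` in the series
`∑ h, u ^ h * (f (h + 1) true + b * f (h + 1) false)`, where `u` is divisible by `X`. -/
noncomputable def labelSum (u b : R⟦X⟧) (n : ℕ) (f : ℕ → Bool → R) : R :=
  ∑ h ∈ Finset.range (n + 1),
    (coeff n (u ^ h) * f (h + 1) true + coeff n (b * u ^ h) * f (h + 1) false)

/-- The generating function of the nodes with label `(h + 1, true)` is `u ^ h`, and that of the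
nodes with label `(h + 1, false)` is `b * u ^ h`. -/
theorem labelSum_desStep (q : R) {u b I w : R⟦X⟧} (hI : (1 - u) * I = 1) (huI : u * I = w)
    (hb : b = C q * w * u) (hu : u = X * (1 + C q * w + C q * b * I)) (n : ℕ)
    (f : ℕ → Bool → R) :
    labelSum u b n (desStep q f) = labelSum u b (n + 1) f := by
  have hXu : X ∣ u := ⟨_, hu⟩
  have hXb : X ∣ b := hb ▸ hXu.mul_left _
  -- the words of the next size with label `(i + 2, true)`, counted by their parents
  have hK : ∀ i ∈ Finset.range (n + 1), ∑ h ∈ Finset.Ico i (n + 1),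
      (coeff n (u ^ h) * gapWeight q true (h + 1) i +
        coeff n (b * u ^ h) * gapWeight q false (h + 1) i) = coeff (n + 1) (u ^ (i + 1)) := by
    intro i hi
    have hi' : i < n + 1 := Finset.mem_range.1 hi
    have e1 : ∀ h ∈ Finset.Ico (i + 1) (n + 1), gapWeight q true (h + 1) i = q := by
      intro h hh
      have := (Finset.mem_Ico.1 hh).1
      rw [gapWeight, if_neg]
      omega
    have e2 : ∀ h, gapWeight q false (h + 1) i = q := fun h => by simp [gapWeight]
    have e3 : ∑ h ∈ Finset.Ico i (n + 1), coeff n (u ^ h) * gapWeight q true (h + 1) i =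
        coeff n (u ^ i) + coeff n (u ^ (i + 1) * I) * q := by
      rw [Finset.sum_eq_sum_Ico_succ_bot hi', Finset.sum_congr rfl fun h hh => by rw [e1 h hh],
        ← Finset.sum_mul]
      have := sum_Ico_coeff_pow hXu hI 1 (show i + 1 ≤ n + 1 by omega)
      simp only [one_mul] at this
      rw [this]
      simp [gapWeight]
    rw [Finset.sum_add_distrib, e3]
    simp only [e2]
    rw [← Finset.sum_mul, sum_Ico_coeff_pow hXu hI b hi'.le]
    have e4 : u ^ (i + 1) =
        X * (u ^ i + u ^ (i + 1) * I * C q + b * u ^ i * I * C q) := by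
      calc u ^ (i + 1) = u ^ i * u := pow_succ _ _
        _ = u ^ i * (X * (1 + C q * w + C q * b * I)) := by rw [← hu]
        _ = _ := by rw [← huI]; ring
    conv_rhs => rw [e4, coeff_succ_X_mul, map_add, map_add, coeff_mul_C, coeff_mul_C]
  have hK2 : ∀ j ∈ Finset.range (n + 1), ∑ i ∈ Finset.Ico (j + 1) (n + 1),
      q * coeff (n + 1) (u ^ (i + 1)) = coeff (n + 1) (b * u ^ j) := by
    intro j hj
    have hj' : j < n + 1 := Finset.mem_range.1 hj
    have := sum_Ico_coeff_pow hXu hI 1 (show j + 1 + 1 ≤ n + 1 + 1 by omega)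
    simp only [one_mul] at this
    rw [← Finset.mul_sum, Finset.sum_Ico_add' (fun i => coeff (n + 1) (u ^ i)), this,
      ← coeff_C_mul, hb, ← huI]
    congr 1
    ring
  have hL : labelSum u b n (desStep q f) =
      ∑ h ∈ Finset.range (n + 1), ∑ j ∈ Finset.range (h + 1),
        (coeff n (u ^ h) * gapWeight q true (h + 1) j +
          coeff n (b * u ^ h) * gapWeight q false (h + 1) j) * f (j + 2) true +
      ∑ h ∈ Finset.range (n + 1), ∑ j ∈ Finset.range (h + 1),
        ∑ i ∈ (Finset.range (h + 1)).filter (fun i => j < i),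
        q * (coeff n (u ^ h) * gapWeight q true (h + 1) i +
          coeff n (b * u ^ h) * gapWeight q false (h + 1) i) * f (j + 1) false := by
    rw [labelSum, ← Finset.sum_add_distrib]
    refine Finset.sum_congr rfl fun h _ => ?_
    simp only [desStep, mul_add, Finset.mul_sum, add_mul, Finset.sum_add_distrib]
    rw [add_add_add_comm]
    congr 2 <;> congr 1 <;> funext j <;>
      first
      | ring1
      | exact Finset.sum_congr rfl fun i _ => by ring
  rw [hL]
  have hA : ∑ h ∈ Finset.range (n + 1), ∑ j ∈ Finset.range (h + 1),
        (coeff n (u ^ h) * gapWeight q true (h + 1) j +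
          coeff n (b * u ^ h) * gapWeight q false (h + 1) j) * f (j + 2) true =
      ∑ j ∈ Finset.range (n + 1), coeff (n + 1) (u ^ (j + 1)) * f (j + 2) true := by
    rw [Finset.sum_comm' (t' := Finset.range (n + 1)) (s' := fun j => Finset.Ico j (n + 1))
      (by intro h j; simp only [Finset.mem_range, Finset.mem_Ico]; omega)]
    refine Finset.sum_congr rfl fun j hj => ?_
    rw [← Finset.sum_mul, hK j hj]
  have hB : ∑ h ∈ Finset.range (n + 1), ∑ j ∈ Finset.range (h + 1),
        ∑ i ∈ (Finset.range (h + 1)).filter (fun i => j < i),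
        q * (coeff n (u ^ h) * gapWeight q true (h + 1) i +
          coeff n (b * u ^ h) * gapWeight q false (h + 1) i) * f (j + 1) false =
      ∑ j ∈ Finset.range (n + 1), coeff (n + 1) (b * u ^ j) * f (j + 1) false := by
    rw [Finset.sum_comm' (t' := Finset.range (n + 1)) (s' := fun j => Finset.Ico j (n + 1))
      (by intro h j; simp only [Finset.mem_range, Finset.mem_Ico]; omega)]
    refine Finset.sum_congr rfl fun j hj => ?_
    rw [Finset.sum_comm' (t' := Finset.Ico (j + 1) (n + 1)) (s' := fun i => Finset.Ico i (n + 1))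
      (by intro h i; simp only [Finset.mem_range, Finset.mem_Ico, Finset.mem_filter]; omega),
      ← hK2 j hj, Finset.sum_mul]
    refine Finset.sum_congr rfl fun i hi => ?_
    rw [← Finset.sum_mul, ← Finset.mul_sum, hK i (Finset.mem_range.2 (Finset.mem_Ico.1 hi).2)]
  have hlast : coeff (n + 1) (b * u ^ (n + 1)) = 0 := by
    refine X_pow_dvd_iff.1 (?_ : X ^ (n + 2) ∣ _) (n + 1) (by omega)
    rw [pow_succ']
    exact mul_dvd_mul hXb (pow_dvd_pow_of_dvd hXu (n + 1))
  rw [hA, hB, labelSum, Finset.sum_add_distrib]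
  congr 1
  · rw [Finset.sum_range_succ' _ (n + 1)]
    simp [coeff_one]
  · rw [Finset.sum_range_succ _ (n + 1), hlast, zero_mul, add_zero]

theorem sum_des_eq_labelSum (q : R) {u b I w : R⟦X⟧} (hI : (1 - u) * I = 1) (huI : u * I = w)
    (hb : b = C q * w * u) (hu : u = X * (1 + C q * w + C q * b * I)) (n m : ℕ)
    (f : ℕ → Bool → R) :
    ∑ v ∈ words (· > ·) m n, q ^ des v * f (goodSuffixes (· > ·) v).card (hasFreeGap v) =
      labelSum u b n f := by
  induction n generalizing m f with
  | zero =>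
    have h : (goodSuffixes (· > ·) []).card = 1 :=
      Finset.card_eq_one.2 ⟨[], Finset.ext fun S => by
        rw [Finset.mem_singleton]
        exact ⟨fun h => List.suffix_nil.1 (mem_goodSuffixes.1 h).1,
          by rintro rfl; exact nil_mem_goodSuffixes _ _⟩⟩
    have h2 : hasFreeGap [] = true := by
      have : ∃ A C, [] = A ++ C ∧ GoodSuffix (· > ·) C ∧ FreeGap A C :=
        ⟨[], [], rfl, by simp [GoodSuffix], Or.inl rfl⟩
      simpa [hasFreeGap] using this
    have hu0 : constantCoeff u = 0 := X_dvd_iff.1 ⟨_, hu⟩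
    simp [words_zero, h, h2, labelSum, des, hb, hu0]
  | succ n ih => rw [sum_des_succ, ih, labelSum_desStep q hI huI hb hu]

/-- The descent polynomial of the `132`-avoiding Stirling words is a coefficient of
`1 + w + q w²`, where `w = X (1 + w) (1 + q w + q² w²)`. -/
theorem sum_des_eq_coeff (q : R) {w : R⟦X⟧}
    (hw : w = X * ((1 + w) * (1 + C q * w + C q ^ 2 * w ^ 2))) (n m : ℕ) :
    ∑ v ∈ words (· > ·) m n, q ^ des v = coeff n (1 + w + C q * w ^ 2) := by
  -- the series `u` is `w / (1 + w)`, so `1 + w` is the inverse of `1 - u`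
  obtain ⟨u, hu⟩ : ∃ u, u = X * (1 + C q * w + C q ^ 2 * w ^ 2) := ⟨_, rfl⟩
  have huw : u * (1 + w) = w := by
    conv_rhs => rw [hw]
    rw [hu]; ring
  have hI : (1 - u) * (1 + w) = 1 := by rw [sub_mul, huw]; ring
  have h := sum_des_eq_labelSum q (b := C q * w * u) hI huw rfl
    (by rw [mul_assoc (C q), mul_assoc (C q * w), huw]; rw [hu]; ring) n m (fun _ _ => 1)
  simp only [mul_one] at h
  have h0 := sum_Ico_coeff_pow (g := 1 + C q * w * u) (j := 0) (n := n) ⟨_, hu⟩ hI (by omega)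
  rw [h, labelSum]
  simp only [mul_one, ← map_add]
  rw [show (1 + w + C q * w ^ 2 : R⟦X⟧) = (1 + C q * w * u) * u ^ 0 * (1 + w) by
    rw [pow_zero, mul_one, add_mul, mul_assoc (C q * w), huw]; ring, ← h0, Nat.Ico_zero_eq_range]
  exact Finset.sum_congr rfl fun h _ => by rw [add_mul, one_mul]

end

/-! ### Coefficient extraction -/

section

open Polynomial

/-- The coefficients of `(1 + X + X²) ^ N`, written as `(1 + X (1 + X)) ^ N`. -/
theorem coeff_trinomial_pow (N m : ℕ) :
    ((1 + X + X ^ 2 : ℚ[X]) ^ N).coeff m =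
      ∑ j ∈ Finset.range (N + 1), (N.choose j : ℚ) * if j ≤ m then (j.choose (m - j) : ℚ) else 0 := by
  rw [show (1 + X + X ^ 2 : ℚ[X]) = X * (1 + X) + 1 by ring, add_pow, finsetSum_coeff]
  refine Finset.sum_congr rfl fun j _ => ?_
  rw [one_pow, mul_one, mul_pow, ← C_eq_natCast, coeff_mul_C, coeff_X_pow_mul', mul_comm]
  split_ifs
  · rw [coeff_one_add_X_pow]
  · rfl

theorem succ_mul_coeff_derivative_trinomial (n d : ℕ) :
    ((n + 1 : ℕ) : ℚ) * (((1 + 2 * X) * (1 + X + X ^ 2) ^ n : ℚ[X])).coeff d =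
      ((1 + X + X ^ 2 : ℚ[X]) ^ (n + 1)).coeff (d + 1) * ((d : ℚ) + 1) := by
  rw [← coeff_derivative, ← coeff_C_mul]
  congr 1
  rw [derivative_pow]
  simp
  ring

theorem exists_descent_series {R : Type*} [CommRing R] (q : R) :
    ∃ w : PowerSeries R, w =
      PowerSeries.X * ((1 + w) * (1 + PowerSeries.C q * w + PowerSeries.C q ^ 2 * w ^ 2)) := by
  have hal : algebraMap R (PowerSeries R) = PowerSeries.C := rfl
  obtain ⟨w, hw⟩ := exists_eq_X_mul_aeval ((1 + X) * (1 + C q * X + C q ^ 2 * X ^ 2) : R[X])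
  exact ⟨w, by simpa [hal] using hw⟩

/-- Lagrange inversion for the series `w = X (1 + w) (1 + q w + q² w²)`. -/
theorem succ_mul_coeff_descent_series {R : Type*} [CommRing R] [IsDomain R] [CharZero R] (q : R)
    {w : PowerSeries R}
    (hw : w = PowerSeries.X * ((1 + w) * (1 + PowerSeries.C q * w + PowerSeries.C q ^ 2 * w ^ 2)))
    (n : ℕ) :
    ((n + 1 : ℕ) : R) * PowerSeries.coeff (n + 1) (1 + w + PowerSeries.C q * w ^ 2) =
      (((1 + 2 * X) * (1 + X + X ^ 2) ^ (n + 1) : R[X]).comp (C q * X) *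
        (1 + X) ^ (n + 1)).coeff n := by
  have hal : algebraMap R (PowerSeries R) = PowerSeries.C := rfl
  have hw' : w = PowerSeries.X *
      aeval w ((1 + X) * (1 + C q * X + C q ^ 2 * X ^ 2) : R[X]) := by
    simpa [hal] using hw
  have hL := lagrange_inversion hw' n (X + C q * X ^ 2)
  have h1 : PowerSeries.coeff (n + 1) (aeval w (X + C q * X ^ 2 : R[X])) =
      PowerSeries.coeff (n + 1) (1 + w + PowerSeries.C q * w ^ 2) := by
    simp [hal, PowerSeries.coeff_one]
  have h2 : derivative (X + C q * X ^ 2 : R[X]) *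
        ((1 + X) * (1 + C q * X + C q ^ 2 * X ^ 2)) ^ (n + 1) =
      ((1 + 2 * X) * (1 + X + X ^ 2) ^ (n + 1) : R[X]).comp (C q * X) *
        (1 + X) ^ (n + 1) := by
    simp [mul_pow]
    ring
  rw [← h1, hL, h2]

theorem succ_mul_coeff_coeff_descent_series {w : PowerSeries ℚ[X]}
    (hw : w = PowerSeries.X * ((1 + w) * (1 + PowerSeries.C X * w + PowerSeries.C X ^ 2 * w ^ 2)))
    (n d : ℕ) :
    ((n + 1 : ℕ) : ℚ) *
        (PowerSeries.coeff (n + 1) (1 + w + PowerSeries.C X * w ^ 2)).coeff d =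
      (((1 + 2 * X) * (1 + X + X ^ 2) ^ (n + 1) : ℚ[X])).coeff d * ((n + 1).choose (d + 1) : ℚ) := by
  have hL := succ_mul_coeff_descent_series X hw n
  rw [show ((1 + 2 * X) * (1 + X + X ^ 2) ^ (n + 1) : ℚ[X][X]) =
    ((1 + 2 * X) * (1 + X + X ^ 2) ^ (n + 1) : ℚ[X]).map C by simp, coeff_mul] at hL
  have h3 := congrArg (fun p : ℚ[X] => p.coeff d) hL
  simp only [← C_eq_natCast, coeff_C_mul, finsetSum_coeff] at h3
  rw [h3]
  generalize ((1 + 2 * X) * (1 + X + X ^ 2) ^ (n + 1) : ℚ[X]) = P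
  simp only [comp_C_mul_X_coeff, coeff_map, coeff_one_add_X_pow]
  simp only [← C_eq_natCast, coeff_mul_C, coeff_C_mul, coeff_X_pow]
  rw [Finset.Nat.sum_antidiagonal_eq_sum_range_succ_mk]
  simp only [mul_ite, mul_one, mul_zero, ite_mul, zero_mul, Finset.sum_ite_eq, Finset.mem_range]
  split_ifs with h
  · rw [← Nat.choose_symm (show d + 1 ≤ n + 1 by omega), Nat.add_sub_add_right]
  · rw [Nat.choose_eq_zero_of_lt (by omega)]
    simp

theorem coeff_sum_X_pow (s : Finset (List ℕ)) (g : List ℕ → ℕ) (d : ℕ) :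
    (∑ v ∈ s, (X : ℚ[X]) ^ g v).coeff d = ((s.filter fun v => g v = d).card : ℚ) := by
  simp [coeff_X_pow, eq_comm]

end

theorem card_words_filter_des (n m d : ℕ) :
    (((words (· > ·) m (n + 1)).filter fun v => des v = d).card : ℚ) =
      (n.choose d : ℚ) / (n + 2) * ∑ j ∈ Finset.range (n + 3),
        ((n + 2).choose j : ℚ) * if j ≤ d + 1 then (j.choose (d + 1 - j) : ℚ) else 0 := by
  obtain ⟨w, hw⟩ := exists_descent_series (Polynomial.X : Polynomial ℚ)
  have h1 := succ_mul_coeff_coeff_descent_series hw n d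
  rw [← sum_des_eq_coeff Polynomial.X hw (n + 1) m, coeff_sum_X_pow] at h1
  have h2 := succ_mul_coeff_derivative_trinomial (n + 1) d
  rw [coeff_trinomial_pow] at h2
  have h3 : ((n : ℚ) + 1) * n.choose d = (n + 1).choose (d + 1) * (d + 1) := by
    exact_mod_cast Nat.add_one_mul_choose_eq n d
  push_cast at h1 h2
  have hn1 : (n : ℚ) + 1 ≠ 0 := by positivity
  have hn2 : (n : ℚ) + 2 ≠ 0 := by positivity
  rw [div_mul_eq_mul_div, eq_div_iff hn2]
  refine mul_left_cancel₀ hn1 ?_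
  linear_combination ((n : ℚ) + 2) * h1 + ((n + 1).choose (d + 1) : ℚ) * h2 -
    (∑ j ∈ Finset.range (n + 3),
        ((n + 2).choose j : ℚ) * if j ≤ d + 1 then (j.choose (d + 1 - j) : ℚ) else 0) * h3

/-! ### The two enumerations -/

theorem binom_sub (j m : ℕ) :
    (binom j ((m : ℤ) - j) : ℚ) = if j ≤ m then (j.choose (m - j) : ℚ) else 0 := by
  unfold binom
  split_ifs with h1 h2 h2
  · rw [Int.toNat_natCast, show ((m : ℤ) - j).toNat = m - j by omega]
  · omega
  · omega
  · rfl

theorem theorem3 (n : ℕ) :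
    (∑ σ ∈ avoiders n [1, 3, 2], (Polynomial.X : Polynomial ℤ) ^ plat σ
      = ∑ σ ∈ avoiders n [1, 2, 3], (Polynomial.X : Polynomial ℤ) ^ plat σ) ∧
    ∀ d : ℕ,
      (((avoiders n [1, 3, 2]).filter fun σ => des σ = d).card : ℚ)
        = (binom ((n : ℤ) - 1) d : ℚ) / ((n : ℚ) + 1)
          * ∑ j ∈ Finset.range (n + 2),
              (binom ((n : ℤ) + 1) j : ℚ) * (binom j ((d : ℤ) + 1 - j) : ℚ) := by
  rw [avoiders_eq_words n _ _ not_containsPattern_132_iff,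
    avoiders_eq_words n _ _ not_containsPattern_123_iff]
  refine ⟨by simpa using sum_plat_gt_eq_lt (Polynomial.X : Polynomial ℤ) n 1 fun _ => 1,
    fun d => ?_⟩
  cases n with
  | zero =>
    rw [words_zero]
    rcases Nat.eq_zero_or_pos d with rfl | hd
    · norm_num [Finset.sum_range_succ, binom, des, Finset.filter_singleton]
    · have h1 : des [] ≠ d := hd.ne
      have h2 : binom (((0 : ℕ) : ℤ) - 1) d = 0 := by
        simp only [binom]
        rw [if_pos (by omega)]
        exact Nat.choose_eq_zero_of_lt (by omega)
      rw [Finset.filter_singleton, if_neg h1, h2]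
      simp
  | succ n =>
    rw [card_words_filter_des]
    have h1 : binom (((n + 1 : ℕ) : ℤ) - 1) d = n.choose d := by
      simp [binom]
    rw [h1]
    congr 1
    · push_cast; ring
    · refine Finset.sum_congr rfl fun j _ => ?_
      have h2 := binom_sub j (d + 1)
      push_cast at h2
      rw [h2]
      congr 1
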